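/- Let $k$ be a field of characteristic zero, let $n$ be even, and let $r>n$ be an integer. Let $T_g=k[t_{(i,j)} : 1\le i\le j\le n]$ be the polynomial ring, with the convention $t_{(j,i)}=t_{(i,j)}$. The generic Clifford algebra $A_g$ of rank $n$ is the Clifford algebra over $T_g$ of the quadratic form $q_g(v)=\sum_{i,j}t_{(i,j)}v_iv_j$ on the free module $\bigoplus_{i=1}^n T_g x_i$; that is, the $T_g$-algebra generated by $x_1,\dots,x_n$ with relations $x_ix_j+x_jx_i=2t_{(i,j)}$. It is a graded $k$-algebra with $\deg x_i=1$ and $\deg t_{(i,j)}=2$. Let $B_{g,r}$ be the graded $k$-subalgebra of $A_g$ generated by all $t_{(i,j)}$ and all $$z_i=x_i\Bigl(\prod_{1\le a\le b\le n}t_{(a,b)}\Bigr)^{r},\qquad i=1,\dots,n.$$ Then every $k$-algebra automorphism of $B_{g,r}$ is graded, i.e. maps each homogeneous component of $B_{g,r}$ onto itself, and $$\operatorname{Aut}(B_{g,r})\cong S_n\ltimes (k^\times)^n,$$ where $S_n$ acts on $(k^\times)^n$ by permuting the coordinates, $(\sigma\cdot d)_i=d_{\sigma^{-1}(i)}$.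 More precisely, there is a group isomorphism from $S_n\ltimes(k^\times)^n$ onto $\operatorname{Aut}(B_{g,r})$ under which $(d,\sigma)$, with $d\in(k^\times)^n$ and $\sigma\in S_n$, corresponds to the automorphism given by $$t_{(i,j)}\mapsto d_{\sigma(i)}d_{\sigma(j)}\,t_{(\sigma(i),\sigma(j))},\qquad z_i\mapsto d_{\sigma(i)}\Bigl(\prod_{m=1}^n d_m\Bigr)^{(n+1)r}z_{\sigma(i)}.$$ -/

import Mathlib

open scoped BigOperators

noncomputable section

namespace GenericClifford

/-- The polynomial ring `T_g = k[t_(i,j)]`. The variables are indexed by unordered pairs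
`s(i, j)` with `i = j` allowed, i.e. by `{(i, j)} / ((i, j) ∼ (j, i))`. -/
abbrev BaseRing (k : Type*) [Field k] (n : ℕ) : Type _ :=
  MvPolynomial (Sym2 (Fin n)) k

/-- The generic symmetric matrix `(t_(i,j))`. -/
def genericMatrix (k : Type*) [Field k] (n : ℕ) : Matrix (Fin n) (Fin n) (BaseRing k n) :=
  Matrix.of fun i j => MvPolynomial.X s(i, j)

/-- The generic quadratic form `q_g(v) = b_g(v, v)` on the free module of rank `n`, where `b_g` is
the bilinear form with `b_g(x_i, x_j) = t_(i,j)`. -/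
def genericForm (k : Type*) [Field k] (n : ℕ) :
    QuadraticForm (BaseRing k n) (Fin n → BaseRing k n) :=
  (genericMatrix k n).toQuadraticForm'

/-- The generic Clifford algebra `A_g` of rank `n`. It is a `k`-algebra through `k → T_g`. -/
abbrev Alg (k : Type*) [Field k] (n : ℕ) : Type _ :=
  CliffordAlgebra (genericForm k n)

/-- The generator `x_i` of `A_g`. -/
def x (k : Type*) [Field k] (n : ℕ) (i : Fin n) : Alg k n :=
  CliffordAlgebra.ι (genericForm k n) (Pi.single i 1)

/-- The central element `t_(i,j)` of `A_g`. -/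
def t (k : Type*) [Field k] (n : ℕ) (i j : Fin n) : Alg k n :=
  algebraMap (BaseRing k n) (Alg k n) (MvPolynomial.X s(i, j))

/-- The product of all the variables `t_(i,j)`, `i ≤ j`, each taken once. -/
def tProd (k : Type*) [Field k] (n : ℕ) : BaseRing k n :=
  ∏ p : Sym2 (Fin n), MvPolynomial.X p

/-- The element `z_i = x_i (∏ t_(a,b)) ^ r` of `A_g`. -/
def z (k : Type*) [Field k] (n r : ℕ) (i : Fin n) : Alg k n :=
  x k n i * algebraMap (BaseRing k n) (Alg k n) (tProd k n ^ r)

/-- The component of degree `m` of `A_g` for the grading with `deg x_i = 1` and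
`deg t_(i,j) = 2`: the `k`-span of all products of a monomial `t ^ α` and a word in the `x_i` of
total degree `m`. -/
def piece (k : Type*) [Field k] (n m : ℕ) : Submodule k (Alg k n) :=
  Submodule.span k {a | ∃ (α : Sym2 (Fin n) →₀ ℕ) (w : List (Fin n)),
    2 * α.degree + w.length = m ∧
      a = algebraMap (BaseRing k n) (Alg k n) (MvPolynomial.monomial α 1) *
        (w.map (x k n)).prod}

/-- The `k`-subalgebra `B_{g,r}` of `A_g` generated by all `t_(i,j)` and all `z_i`. -/
def B (k : Type*) [Field k] (n r : ℕ) : Subalgebra k (Alg k n) :=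
  Algebra.adjoin k ({a | ∃ i j, a = t k n i j} ∪ {a | ∃ i, a = z k n r i})

/-- `t_(i,j)` as an element of `B_{g,r}`. -/
def tB (k : Type*) [Field k] (n r : ℕ) (i j : Fin n) : B k n r :=
  ⟨t k n i j, Algebra.subset_adjoin (Or.inl ⟨i, j, rfl⟩)⟩

/-- `z_i` as an element of `B_{g,r}`. -/
def zB (k : Type*) [Field k] (n r : ℕ) (i : Fin n) : B k n r :=
  ⟨z k n r i, Algebra.subset_adjoin (Or.inr ⟨i, rfl⟩)⟩

/-- The component of degree `m` of `B_{g,r}`, for the grading induced from `A_g`. -/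
def pieceB (k : Type*) [Field k] (n r m : ℕ) : Submodule k (B k n r) :=
  (piece k n m).comap (B k n r).val.toLinearMap

/-- An automorphism of `B_{g,r}` is graded if it maps every homogeneous component onto itself. -/
def IsGradedAut {k : Type*} [Field k] {n r : ℕ} (g : B k n r ≃ₐ[k] B k n r) : Prop :=
  ∀ m : ℕ, (pieceB k n r m).map g.toLinearMap = pieceB k n r m

/-- The group `(k^×)^n ⋊ S_n`, where `S_n` permutes the coordinates:
`(σ • d) i = d (σ⁻¹ i)`. -/
abbrev MonomialGroup (k : Type*) [Field k] (n : ℕ) : Type _ :=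
  (Fin n → kˣ) ⋊[mulAutArrow] Equiv.Perm (Fin n)

end GenericClifford

end

/-! Write T for T_g, A for A_g, B for B_{g,r} and P for the product of all t_(a,b) (`tProd`), so
that z_i = P^r x_i.

A monomial substitution of the t_(i,j) and x_i extends to A by the universal property. It multiplies
P by (∏ d_m)^(n+1), because each index occurs n + 1 times in P. It therefore preserves B and its
grading, and this gives the homomorphism from the monomial group (`exists_monoidHom`).

Conversely, let g be an automorphism of B. Since n is even, the centre of A, and hence that of B, is
T, so g restricts to an automorphism γ of T. The rigidity of γ comes from B ⊆ T + P^r A: commutators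
in B lie in P^(2r) A, so a scalar that is the square of a commutator is divisible by P^(4r). The
square of [z_i, z_j] is P^(4r) G with G = 4(t_(i,j)^2 - t_(i,i) t_(j,j)) of degree at most 2.
Applying the divisibility to g⁻¹ gives γ(P)^(4r) ∣ P^(4r) G. A prime γ(t_p) not dividing P would
then divide G at least three times, which the degree forbids. Hence γ permutes the variables up to
scalars (`exists_map_X`).

Now g(z_i)^2 = γ(z_i^2) is homogeneous. As A is a domain (`noZeroDivisors_alg`), g(z_i) is
homogeneous too, of the degree of z_i. That degree is odd, so g(z_i) = P^r η with η of degree 1, a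
k-combination of the x_j (`exists_map_zB`). Comparing the Clifford relations leaves one nonzero
coefficient for each i, and g is monomial (`exists_monomial`).

To see that A is a domain, the generic symmetric matrix is written as U S² Uᵀ and A is embedded in
polynomials over the Clifford algebra of a sum of squares. There each coefficient of an image
element lies on a line whose nonzero elements are units. -/

namespace CliffordAlgebra

/-! ### Words in the generators, contractions and the number operator -/

section Words

variable {R : Type*} [CommRing R] {n : ℕ} (Q : QuadraticForm R (Fin n → R))

/-- The generator of the Clifford algebra attached to the `i`-th standard basis vector. -/
noncomputable def gen (i : Fin n) : CliffordAlgebra Q := ι Q (Pi.single i 1)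

/-- Left contraction with the `j`-th coordinate functional. -/
noncomputable def del (j : Fin n) : CliffordAlgebra Q →ₗ[R] CliffordAlgebra Q :=
  contractLeft (LinearMap.proj j : (Fin n → R) →ₗ[R] R)

/-- The Gram matrix of the polar form in the standard basis. -/
noncomputable def gram : Matrix (Fin n) (Fin n) R :=
  Matrix.of fun i j => QuadraticMap.polar Q (Pi.single i 1) (Pi.single j 1)

/-- The span of the words in the generators whose length is at most `m` and has the parity
of `m`. -/
noncomputable def wordSpan (m : ℕ) : Submodule R (CliffordAlgebra Q) :=
  Submodule.span R {a | ∃ w : List (Fin n), w.length ≤ m ∧ w.length % 2 = m % 2 ∧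
    a = (w.map (gen Q)).prod}

/-- The operator `∑ j, x_j ∂_j`. -/
noncomputable def number : CliffordAlgebra Q →ₗ[R] CliffordAlgebra Q :=
  ∑ j, LinearMap.mulLeft R (gen Q j) ∘ₗ del Q j

theorem number_apply (b : CliffordAlgebra Q) : number Q b = ∑ j, gen Q j * del Q j b := by
  simp [number]

theorem gram_symm (i j : Fin n) : gram Q i j = gram Q j i := by
  simp [gram, QuadraticMap.polar_comm]

theorem gen_mul_gen_add (i j : Fin n) :
    gen Q i * gen Q j + gen Q j * gen Q i = algebraMap R _ (gram Q i j) := by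
  simp [gen, gram, ι_mul_ι_add_swap]

theorem ι_eq_sum (v : Fin n → R) : ι Q v = ∑ i, v i • gen Q i := by
  conv_lhs => rw [pi_eq_sum_univ' v]
  simp [gen, map_sum]

theorem del_gen_mul (i j : Fin n) (b : CliffordAlgebra Q) :
    del Q j (gen Q i * b) = (if i = j then b else 0) - gen Q i * del Q j b := by
  simp only [del, gen, contractLeft_ι_mul]
  by_cases h : i = j
  · subst h; simp
  · simp [h, Ne.symm h]

theorem del_one (j : Fin n) : del Q j 1 = 0 := by simp [del]

theorem involute_gen (i : Fin n) : involute (gen Q i) = -gen Q i := by simp [gen]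

/-- The graded commutator with u is an antiderivation killing scalars and sending a vector v to the
polar form of u and v; these properties determine contraction. -/
theorem ι_mul_sub_involute_mul_ι (u : Fin n → R) (b : CliffordAlgebra Q) :
    ι Q u * b - involute b * ι Q u = contractLeft (Q.polarBilin u) b := by
  induction b using CliffordAlgebra.left_induction with
  | algebraMap r => simp [Algebra.commutes]
  | add a b ha hb => rw [map_add, map_add, ← ha, ← hb]; noncomm_ring
  | ι_mul b v hb =>
    rw [contractLeft_ι_mul, ← hb, map_mul, involute_ι, Algebra.smul_def,
      QuadraticMap.polarBilin_apply_apply, ← ι_mul_ι_add_swap]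
    noncomm_ring

theorem gen_mul_sub (i : Fin n) (b : CliffordAlgebra Q) :
    gen Q i * b - involute b * gen Q i = ∑ j, gram Q i j • del Q j b := by
  rw [gen, ι_mul_sub_involute_mul_ι]
  have : Q.polarBilin (Pi.single i 1) =
      ∑ j, gram Q i j • (LinearMap.proj j : (Fin n → R) →ₗ[R] R) := by
    refine LinearMap.pi_ext' fun l => LinearMap.ext_ring ?_
    simp [gram, Pi.single_apply]
  simp [this, del]

theorem prod_mem_wordSpan (w : List (Fin n)) : (w.map (gen Q)).prod ∈ wordSpan Q w.length :=
  Submodule.subset_span ⟨w, le_rfl, rfl, rfl⟩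

theorem gen_mul_mem_wordSpan (i : Fin n) {m : ℕ} {b : CliffordAlgebra Q} (hb : b ∈ wordSpan Q m) :
    gen Q i * b ∈ wordSpan Q (m + 1) := by
  induction hb using Submodule.span_induction with
  | mem b h =>
    obtain ⟨w, h1, h2, rfl⟩ := h
    exact Submodule.subset_span ⟨i :: w, by simpa using h1, by simp; omega, by simp⟩
  | zero => simp
  | add a b _ _ ha hb => rw [mul_add]; exact add_mem ha hb
  | smul r a _ ha => rw [mul_smul_comm]; exact Submodule.smul_mem _ _ ha

theorem wordSpan_induction {P : CliffordAlgebra Q → Prop}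
    (word : ∀ w : List (Fin n), P (w.map (gen Q)).prod)
    (add : ∀ a b, P a → P b → P (a + b)) (smul : ∀ (r : R) a, P a → P (r • a))
    (b : CliffordAlgebra Q) : P b := by
  have key : b ∈ Submodule.span R (Set.range fun w : List (Fin n) => (w.map (gen Q)).prod) := by
    induction b using CliffordAlgebra.left_induction with
    | algebraMap r =>
      rw [Algebra.algebraMap_eq_smul_one]
      exact Submodule.smul_mem _ _ (Submodule.subset_span ⟨[], by simp⟩)
    | add a b ha hb => exact add_mem ha hb
    | ι_mul b v hb =>
      rw [ι_eq_sum, Finset.sum_mul]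
      refine sum_mem fun i _ => ?_
      rw [smul_mul_assoc]
      refine Submodule.smul_mem _ _ ?_
      induction hb using Submodule.span_induction with
      | mem b h =>
        obtain ⟨w, rfl⟩ := h
        exact Submodule.subset_span ⟨i :: w, by simp⟩
      | zero => simp
      | add a b _ _ ha hb => rw [mul_add]; exact add_mem ha hb
      | smul r a _ ha => rw [mul_smul_comm]; exact Submodule.smul_mem _ _ ha
  induction key using Submodule.span_induction with
  | mem b h => obtain ⟨w, rfl⟩ := h; exact word w
  | zero => simpa using smul 0 _ (word [])
  | add a b _ _ ha hb => exact add _ _ ha hb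
  | smul r a _ ha => exact smul _ _ ha

theorem wordSpan_mono {m p : ℕ} (h : m ≤ p) (h2 : m % 2 = p % 2) :
    wordSpan Q m ≤ wordSpan Q p := by
  refine Submodule.span_mono ?_
  rintro a ⟨w, h1, h2, rfl⟩
  exact ⟨w, by omega, by omega, rfl⟩

theorem exists_mem_wordSpan_add (b : CliffordAlgebra Q) :
    ∃ m, ∃ b₀ ∈ wordSpan Q (2 * m), ∃ b₁ ∈ wordSpan Q (2 * m + 1), b = b₀ + b₁ := by
  induction b using wordSpan_induction with
  | word w =>
    rcases Nat.even_or_odd' w.length with ⟨m, h | h⟩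
    · exact ⟨m, _, h ▸ prod_mem_wordSpan Q w, 0, zero_mem _, by simp⟩
    · exact ⟨m, 0, zero_mem _, _, h ▸ prod_mem_wordSpan Q w, by simp⟩
  | add a b ha hb =>
    obtain ⟨m, a₀, ha₀, a₁, ha₁, rfl⟩ := ha
    obtain ⟨p, b₀, hb₀, b₁, hb₁, rfl⟩ := hb
    refine ⟨m + p, a₀ + b₀, add_mem (wordSpan_mono Q ?_ ?_ ha₀)
      (wordSpan_mono Q ?_ ?_ hb₀), a₁ + b₁, add_mem (wordSpan_mono Q ?_ ?_ ha₁)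
      (wordSpan_mono Q ?_ ?_ hb₁), by abel⟩ <;> omega
  | smul r a ha =>
    obtain ⟨m, a₀, ha₀, a₁, ha₁, rfl⟩ := ha
    exact ⟨m, _, Submodule.smul_mem _ r ha₀, _, Submodule.smul_mem _ r ha₁, smul_add _ _ _⟩

theorem mem_range_of_mem_wordSpan_zero {b : CliffordAlgebra Q} (hb : b ∈ wordSpan Q 0) :
    b ∈ Set.range (algebraMap R (CliffordAlgebra Q)) := by
  induction hb using Submodule.span_induction with
  | mem b h =>
    obtain ⟨w, h1, -, rfl⟩ := h
    obtain rfl : w = [] := by simpa using h1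
    exact ⟨1, by simp⟩
  | zero => exact ⟨0, by simp⟩
  | add a b _ _ ha hb =>
    obtain ⟨r, rfl⟩ := ha
    obtain ⟨s, rfl⟩ := hb
    exact ⟨r + s, by simp⟩
  | smul r a _ ha =>
    obtain ⟨s, rfl⟩ := ha
    exact ⟨r * s, by simp [Algebra.smul_def]⟩

theorem involute_of_mem_wordSpan {m : ℕ} {b : CliffordAlgebra Q} (hb : b ∈ wordSpan Q m) :
    involute b = (-1 : R) ^ m • b := by
  induction hb using Submodule.span_induction with
  | mem b h =>
    obtain ⟨w, -, h2, rfl⟩ := h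
    have h3 : (-1 : R) ^ m = (-1) ^ w.length := by
      rw [neg_one_pow_eq_pow_mod_two, ← h2, ← neg_one_pow_eq_pow_mod_two]
    rw [h3]
    clear h2 h3
    induction w with
    | nil => simp
    | cons i w ih =>
      simp only [List.map_cons, List.prod_cons, map_mul, ih, involute_gen, List.length_cons,
        pow_succ]
      simp
  | zero => simp
  | add a b _ _ ha hb => rw [map_add, ha, hb, smul_add]
  | smul r a _ ha => rw [map_smul, ha, smul_comm]

theorem del_mem_wordSpan (j : Fin n) {m : ℕ} {b : CliffordAlgebra Q}
    (hb : b ∈ wordSpan Q (m + 1)) : del Q j b ∈ wordSpan Q m := by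
  induction hb using Submodule.span_induction with
  | mem b h =>
    obtain ⟨w, h1, h2, rfl⟩ := h
    induction w generalizing m with
    | nil => simp [del_one]
    | cons i w ih =>
      simp only [List.length_cons] at h1 h2
      simp only [List.map_cons, List.prod_cons, del_gen_mul]
      refine sub_mem ?_ ?_
      · split_ifs
        · exact Submodule.subset_span ⟨w, by omega, by omega, rfl⟩
        · simp
      · rcases m with _ | m
        · obtain rfl : w = [] := by simpa using h1
          simp [del_one]
        · exact gen_mul_mem_wordSpan Q i (ih (by omega) (by omega))
  | zero => simp
  | add a b _ _ ha hb => rw [map_add]; exact add_mem ha hb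
  | smul r a _ ha => rw [map_smul]; exact Submodule.smul_mem _ _ ha

theorem del_of_mem_wordSpan_zero (j : Fin n) {b : CliffordAlgebra Q}
    (hb : b ∈ wordSpan Q 0) : del Q j b = 0 := by
  obtain ⟨r, rfl⟩ := mem_range_of_mem_wordSpan_zero Q hb
  simp [del]

theorem number_gen_mul (i : Fin n) (b : CliffordAlgebra Q) :
    number Q (gen Q i * b) = gen Q i * b + gen Q i * number Q b
      - ∑ j, gram Q i j • del Q j b := by
  simp only [number_apply, del_gen_mul, mul_sub, Finset.sum_sub_distrib, mul_ite, mul_zero,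
    Finset.sum_ite_eq, Finset.mem_univ, if_true, Algebra.smul_def, ← gen_mul_gen_add,
    add_mul, Finset.sum_add_distrib, Finset.mul_sum, mul_assoc]
  abel

/-- Moving x_i past the operator costs only contractions, which shorten words by one. The second
clause is needed because `w.length - 2` truncates: for length 1 the first clause alone has the wrong
parity to carry the induction. -/
theorem number_word (w : List (Fin n)) :
    number Q (w.map (gen Q)).prod - (w.length : R) • (w.map (gen Q)).prod ∈
      wordSpan Q (w.length - 2) ∧
    (w.length ≤ 1 → number Q (w.map (gen Q)).prod = (w.length : R) • (w.map (gen Q)).prod) := by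
  induction w with
  | nil => simp [number_apply, del_one]
  | cons i w ih =>
    rcases w with _ | ⟨i', w⟩
    · have : number Q (([i].map (gen Q)).prod) = ((1 : ℕ) : R) • ([i].map (gen Q)).prod := by
        have := number_gen_mul Q i 1
        simpa [number_apply, del_one] using this
      refine ⟨?_, fun _ => this⟩
      rw [this]
      simp
    · refine ⟨?_, by simp⟩
      set v := i' :: w with hv
      set p := (v.map (gen Q)).prod with hp
      have hlen : v.length = w.length + 1 := by simp [hv]
      simp only [List.map_cons, List.prod_cons, ← hp, List.length_cons, number_gen_mul]
      have e : gen Q i * p + gen Q i * number Q p - ∑ j, gram Q i j • del Q j p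
          - ((v.length + 1 : ℕ) : R) • (gen Q i * p)
          = gen Q i * (number Q p - (v.length : R) • p) - ∑ j, gram Q i j • del Q j p := by
        push_cast
        rw [add_smul, one_smul, mul_sub, mul_smul_comm]
        abel
      rw [e]
      refine sub_mem ?_ (sum_mem fun j _ => Submodule.smul_mem _ _ ?_)
      · rcases Nat.lt_or_ge v.length 2 with h | h
        · rw [ih.2 (by omega)]; simp
        · have := gen_mul_mem_wordSpan Q i ih.1
          rwa [show v.length - 2 + 1 = v.length + 1 - 2 by omega] at this
      · have := del_mem_wordSpan Q j (m := w.length) (b := p) (hlen ▸ prod_mem_wordSpan Q v)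
        rwa [show v.length + 1 - 2 = w.length by omega]

/-- The number operator acts on each layer of the word filtration as the word length. In
characteristic zero this lets eigenvalues detect layers. -/
theorem number_of_mem {m : ℕ} {b : CliffordAlgebra Q} (hb : b ∈ wordSpan Q (m + 2)) :
    number Q b - ((m + 2 : ℕ) : R) • b ∈ wordSpan Q m := by
  induction hb using Submodule.span_induction with
  | mem b h =>
    obtain ⟨w, h1, h2, rfl⟩ := h
    rcases eq_or_lt_of_le h1 with h | h
    · rw [← h]
      simpa [h] using (number_word Q w).1
    · have hw : (w.map (gen Q)).prod ∈ wordSpan Q m :=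
        Submodule.subset_span ⟨w, by omega, by omega, rfl⟩
      refine sub_mem ?_ (Submodule.smul_mem _ _ hw)
      have h3 := (number_word Q w).1
      have h4 : wordSpan Q (w.length - 2) ≤ wordSpan Q m ∨ w.length ≤ 1 := by
        by_cases h5 : w.length ≤ 1
        · exact .inr h5
        · exact .inl (wordSpan_mono Q (by omega) (by omega))
      rcases h4 with h4 | h4
      · have := add_mem (h4 h3) (Submodule.smul_mem _ (w.length : R) hw)
        simpa using this
      · rw [(number_word Q w).2 h4]
        exact Submodule.smul_mem _ _ hw
  | zero => simp
  | add a b _ _ ha hb =>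
    have := add_mem ha hb
    rw [map_add, smul_add]
    convert this using 1; abel
  | smul r a _ ha =>
    rw [map_smul, smul_comm, ← smul_sub]
    exact Submodule.smul_mem _ _ ha

theorem number_of_mem_one {b : CliffordAlgebra Q} (hb : b ∈ wordSpan Q 1) :
    number Q b = b := by
  induction hb using Submodule.span_induction with
  | mem b h =>
    obtain ⟨w, h1, h2, rfl⟩ := h
    have hw : w.length = 1 := by omega
    simpa [hw] using (number_word Q w).2 h1
  | zero => simp
  | add a b _ _ ha hb => rw [map_add, ha, hb]
  | smul r a _ ha => rw [map_smul, ha]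

theorem number_mem_wordSpan {m : ℕ} {b : CliffordAlgebra Q} (hb : b ∈ wordSpan Q m) :
    number Q b ∈ wordSpan Q m := by
  match m with
  | 0 =>
    rw [number_apply]
    exact sum_mem fun j _ => by simp [del_of_mem_wordSpan_zero Q j hb]
  | m + 1 =>
    rw [number_apply]
    exact sum_mem fun j _ => gen_mul_mem_wordSpan Q j (del_mem_wordSpan Q j hb)

/-- Cramer's rule applied to `gen_mul_sub`. Up to the determinant, contractions are built from left
and right multiplications and the involution, so they preserve involution-stable ideals. -/
theorem det_smul_del (b : CliffordAlgebra Q) (j : Fin n) :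
    (gram Q).det • del Q j b =
      ∑ i, (gram Q).adjugate j i • (gen Q i * b - involute b * gen Q i) := by
  simp only [gen_mul_sub, Finset.smul_sum, smul_smul]
  rw [Finset.sum_comm]
  simp only [← Finset.sum_smul, ← Matrix.mul_apply, Matrix.adjugate_mul]
  simp [Matrix.one_apply, ite_smul]

/-- The adjugate contraction of the products of generators is a scalar. -/
theorem two_smul_sum_adjugate :
    (2 : R) • ∑ j, ∑ i, (gram Q).adjugate j i • (gen Q j * gen Q i) =
      algebraMap R _ (n * (gram Q).det) := by
  have hs : (gram Q).adjugate.transpose = (gram Q).adjugate := by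
    rw [Matrix.adjugate_transpose]
    congr 1
    ext i j
    exact gram_symm Q j i
  have h1 : ∑ j, ∑ i, (gram Q).adjugate j i • (gen Q j * gen Q i) =
      ∑ j, ∑ i, (gram Q).adjugate j i • (gen Q i * gen Q j) := by
    rw [Finset.sum_comm]
    refine Finset.sum_congr rfl fun j _ => Finset.sum_congr rfl fun i _ => ?_
    rw [← congrFun (congrFun hs j) i, Matrix.transpose_apply]
  rw [two_smul]
  nth_rw 2 [h1]
  simp only [← Finset.sum_add_distrib, ← smul_add, gen_mul_gen_add]
  simp only [Algebra.smul_def, ← map_mul, ← map_sum]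
  congr 1
  have h2 : ∀ j, ∑ i, (gram Q).adjugate j i * gram Q j i = (gram Q).det := by
    intro j
    have := congrFun (congrFun (Matrix.adjugate_mul (gram Q)) j) j
    rw [Matrix.mul_apply] at this
    simp only [Matrix.smul_apply, Matrix.one_apply_eq, smul_eq_mul, mul_one] at this
    rw [← this]
    exact Finset.sum_congr rfl fun i _ => by rw [gram_symm]
  simp [h2]

end Words

/-! ### Centre and ideals of a Clifford algebra of even rank over a ℚ-algebra -/

section Center

variable {R : Type*} [CommRing R] {n : ℕ} (Q : QuadraticForm R (Fin n → R))

variable [Algebra ℚ R]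

theorem isUnit_intCast {m : ℤ} (hm : m ≠ 0) : IsUnit (m : R) := by
  have := (IsUnit.mk0 (m : ℚ) (by exact_mod_cast hm)).map (algebraMap ℚ R)
  simpa using this

/-- An eigenvalue c different from the top length m + 2 makes c - (m + 2) invertible, so the top
layer of b vanishes. -/
theorem mem_wordSpan_of_number_eq {c : ℤ} {m : ℕ} {b : CliffordAlgebra Q}
    (hc : c ≠ (m + 2 : ℕ)) (hb : b ∈ wordSpan Q (m + 2)) (h : number Q b = (c : R) • b) :
    b ∈ wordSpan Q m := by
  have h1 := number_of_mem Q hb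
  rw [h, ← sub_smul] at h1
  have h2 : (c : R) - ((m + 2 : ℕ) : R) = ((c - (m + 2 : ℕ) : ℤ) : R) := by push_cast; ring
  rw [h2] at h1
  exact (Submodule.smul_mem_iff_of_isUnit _ (isUnit_intCast (sub_ne_zero.2 hc))).1 h1

theorem mem_wordSpan_zero_of_number_eq_zero {m : ℕ} {b : CliffordAlgebra Q}
    (hb : b ∈ wordSpan Q (2 * m)) (h : number Q b = 0) : b ∈ wordSpan Q 0 := by
  induction m with
  | zero => exact hb
  | succ m ih =>
    refine ih (mem_wordSpan_of_number_eq Q (c := 0) (by push_cast; omega) hb (by simpa using h))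

/-- On odd words the number operator has only odd eigenvalues, so descent through all layers reaches
zero. -/
theorem eq_zero_of_number_eq_of_odd {c : ℤ} (hc : Even c) {m : ℕ} {b : CliffordAlgebra Q}
    (hb : b ∈ wordSpan Q (2 * m + 1)) (h : number Q b = (c : R) • b) : b = 0 := by
  induction m with
  | zero =>
    rw [number_of_mem_one Q hb] at h
    have h1 : ((c - 1 : ℤ) : R) • b = 0 := by
      push_cast; rw [sub_smul, ← h, one_smul, sub_self]
    obtain ⟨d, rfl⟩ := hc
    exact (isUnit_intCast (R := R) (show d + d - 1 ≠ 0 by omega)).smul_eq_zero.1 h1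
  | succ m ih =>
    refine ih (mem_wordSpan_of_number_eq Q (c := c) ?_ hb h)
    obtain ⟨d, rfl⟩ := hc
    push_cast; omega

theorem eq_zero_of_even_of_odd {m p : ℕ} {a b : CliffordAlgebra Q}
    (ha : a ∈ wordSpan Q (2 * m)) (hb : b ∈ wordSpan Q (2 * p + 1)) (h : a + b = 0) :
    a = 0 ∧ b = 0 := by
  have h1 := congrArg involute h
  rw [map_add, involute_of_mem_wordSpan Q ha, involute_of_mem_wordSpan Q hb] at h1
  simp [pow_add, pow_mul] at h1
  have hb' : b = -a := by rw [eq_neg_iff_add_eq_zero, add_comm]; exact h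
  subst hb'
  have h2 : ((2 : ℤ) : R) • a = 0 := by
    push_cast; rw [two_smul]; simpa using h1
  have := (isUnit_intCast (R := R) (show (2 : ℤ) ≠ 0 by norm_num)).smul_eq_zero.1 h2
  simp [this]

theorem mem_range_of_del_eq_zero {b : CliffordAlgebra Q} (h : ∀ j, del Q j b = 0) :
    b ∈ Set.range (algebraMap R (CliffordAlgebra Q)) := by
  have hN : number Q b = 0 := by simp [number_apply, h]
  obtain ⟨m, b₀, hb₀, b₁, hb₁, rfl⟩ := exists_mem_wordSpan_add Q b
  rw [map_add] at hN
  obtain ⟨h₀, h₁⟩ := eq_zero_of_even_of_odd Q (number_mem_wordSpan Q hb₀)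
    (number_mem_wordSpan Q hb₁) hN
  rw [eq_zero_of_number_eq_of_odd Q (c := 0) (by simp) hb₁ (by simpa using h₁), add_zero]
  exact mem_range_of_mem_wordSpan_zero Q (mem_wordSpan_zero_of_number_eq_zero Q hb₀ h₀)

/-- In a `ℚ`-algebra, `2` is invertible. -/
@[reducible] noncomputable def invertibleTwo : Invertible (2 : R) :=
  (isUnit_intCast (R := R) (show (2 : ℤ) ≠ 0 by norm_num)).invertible.copy _ (by simp)

attribute [local instance] invertibleTwo

instance instModuleFree : Module.Free R (CliffordAlgebra Q) :=
  .of_basis (((Pi.basisFun R (Fin n)).ExteriorAlgebra).map (equivExterior Q).symm)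

/-- An `R`-linear retraction of the structure map of the Clifford algebra. -/
noncomputable def scalarPart : CliffordAlgebra Q →ₗ[R] R :=
  ExteriorAlgebra.algebraMapInv.toLinearMap ∘ₗ (equivExterior Q).toLinearMap

theorem scalarPart_algebraMap (r : R) : scalarPart Q (algebraMap R _ r) = r := by
  have : equivExterior Q (algebraMap R _ r) = algebraMap R _ r := 
    changeForm_algebraMap changeForm.associated_neg_proof r
  simp only [scalarPart, LinearMap.comp_apply, LinearEquiv.coe_coe, this]
  exact ExteriorAlgebra.algebraMap_leftInverse (M := Fin n → R) r

theorem algebraMap_injective : Function.Injective (algebraMap R (CliffordAlgebra Q)) :=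
  Function.LeftInverse.injective (scalarPart_algebraMap Q)

variable [IsDomain R]

theorem smul_left_cancel {r : R} (hr : r ≠ 0) {a b : CliffordAlgebra Q} (h : r • a = r • b) :
    a = b := smul_right_injective _ hr h

theorem eq_zero_of_gram_del {b : CliffordAlgebra Q} (hQ : (gram Q).det ≠ 0)
    (h : ∀ i, ∑ j, gram Q i j • del Q j b = 0) (j : Fin n) : del Q j b = 0 := by
  refine smul_left_cancel Q hQ ?_
  have h1 : ∑ i, (gram Q).adjugate j i • ∑ l, gram Q i l • del Q l b = 0 := by simp [h]
  simp only [Finset.smul_sum, smul_smul] at h1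
  rw [Finset.sum_comm] at h1
  simp only [← Finset.sum_smul, ← Matrix.mul_apply, Matrix.adjugate_mul] at h1
  simpa [Matrix.one_apply, ite_smul] using h1

/-- In even rank, an element commuting with all generators is a scalar. -/
theorem mem_range_of_commute_gen (hn : Even n) (hQ : (gram Q).det ≠ 0) {b : CliffordAlgebra Q}
    (hb : ∀ i, gen Q i * b = b * gen Q i) :
    b ∈ Set.range (algebraMap R (CliffordAlgebra Q)) := by
  obtain ⟨m, b₀, hb₀, b₁, hb₁, rfl⟩ := exists_mem_wordSpan_add Q b
  have key : ∀ i, gen Q i * b₀ = b₀ * gen Q i ∧ gen Q i * b₁ = b₁ * gen Q i := by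
    intro i
    have inv₀ : involute b₀ = b₀ := by simpa [pow_mul] using involute_of_mem_wordSpan Q hb₀
    have inv₁ : involute b₁ = -b₁ := by
      simpa [pow_add, pow_mul] using involute_of_mem_wordSpan Q hb₁
    have h := hb i
    have h' := congrArg involute h
    simp only [map_mul, map_add, inv₀, inv₁, involute_gen] at h'
    have two : IsUnit ((2 : ℤ) : R) := isUnit_intCast (by norm_num)
    constructor
    · rw [← sub_eq_zero]
      refine two.smul_eq_zero.1 ?_
      push_cast
      rw [two_smul]
      have : (gen Q i * (b₀ + b₁) - (b₀ + b₁) * gen Q i) -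
        (-gen Q i * (b₀ + -b₁) - (b₀ + -b₁) * -gen Q i) = 0 := by rw [h, h']; simp
      rw [← this]; noncomm_ring
    · rw [← sub_eq_zero]
      refine two.smul_eq_zero.1 ?_
      push_cast
      rw [two_smul]
      have : (gen Q i * (b₀ + b₁) - (b₀ + b₁) * gen Q i) +
        (-gen Q i * (b₀ + -b₁) - (b₀ + -b₁) * -gen Q i) = 0 := by rw [h, h']; simp
      rw [← this]; noncomm_ring
  have inv₀ : involute b₀ = b₀ := by simpa [pow_mul] using involute_of_mem_wordSpan Q hb₀
  have inv₁ : involute b₁ = -b₁ := by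
    simpa [pow_add, pow_mul] using involute_of_mem_wordSpan Q hb₁
  -- For the odd part the graded commutator with x_i is 2 x_i b₁. Contracting with the adjugate
  -- gives N b₁ = n b₁ for the number operator N, and n is even whereas b₁ is odd.
  have e₁ : b₁ = 0 := by
    refine eq_zero_of_number_eq_of_odd Q (c := n) (by exact_mod_cast hn) hb₁ ?_
    refine smul_left_cancel Q hQ ?_
    have h1 : ∀ j, (gram Q).det • del Q j b₁ =
        (2 : R) • ∑ i, (gram Q).adjugate j i • (gen Q i * b₁) := by
      intro j
      rw [det_smul_del, Finset.smul_sum]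
      refine Finset.sum_congr rfl fun i _ => ?_
      rw [inv₁, neg_mul, ← (key i).2, sub_neg_eq_add, ← two_smul R, smul_comm]
    have h2 : (gram Q).det • number Q b₁ =
        ((2 : R) • ∑ j, ∑ i, (gram Q).adjugate j i • (gen Q j * gen Q i)) * b₁ := by
      rw [number_apply, Finset.smul_sum]
      simp only [← mul_smul_comm, h1, Finset.smul_sum, Finset.sum_mul, Finset.mul_sum,
        smul_mul_assoc, mul_assoc]
    rw [h2, two_smul_sum_adjugate, ← Algebra.smul_def, smul_smul, mul_comm]
    simp
  rw [e₁, add_zero]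
  -- On the even part the graded commutator is the ordinary one, which vanishes; hence all
  -- contractions vanish.
  refine mem_range_of_del_eq_zero Q (eq_zero_of_gram_del Q hQ fun i => ?_)
  rw [← gen_mul_sub, inv₀, (key i).1, sub_self]

/-- A nonzero two-sided ideal stable under the grade involution contains a nonzero scalar. -/
theorem exists_scalar_mem (hQ : (gram Q).det ≠ 0) (J : Submodule R (CliffordAlgebra Q))
    (hl : ∀ i, ∀ a ∈ J, gen Q i * a ∈ J) (hr : ∀ i, ∀ a ∈ J, a * gen Q i ∈ J)
    (hi : ∀ a ∈ J, involute a ∈ J) {b : CliffordAlgebra Q} (hb : b ∈ J) (hb0 : b ≠ 0) :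
    ∃ r : R, r ≠ 0 ∧ algebraMap R _ r ∈ J := by
  -- Induction on length. Both parities are carried together since b need not be homogeneous; det
  -- times a contraction stays in J and lowers both lengths, until all contractions vanish and b is
  -- a scalar.
  have key : ∀ m, ∀ b ∈ wordSpan Q m ⊔ wordSpan Q (m + 1), b ∈ J → b ≠ 0 →
      ∃ r : R, r ≠ 0 ∧ algebraMap R _ r ∈ J := by
    have base : ∀ b : CliffordAlgebra Q, (∀ j, del Q j b = 0) → b ∈ J → b ≠ 0 →
        ∃ r : R, r ≠ 0 ∧ algebraMap R _ r ∈ J := by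
      intro b h hb hb0
      obtain ⟨r, rfl⟩ := mem_range_of_del_eq_zero Q h
      exact ⟨r, fun h => hb0 (by simp [h]), hb⟩
    have hdel : ∀ j, ∀ b ∈ J, (gram Q).det • del Q j b ∈ J := by
      intro j b hb
      rw [det_smul_del]
      exact sum_mem fun i _ => J.smul_mem _ (sub_mem (hl i b hb) (hr i _ (hi b hb)))
    have step : ∀ b ∈ J, b ≠ 0 → (∀ j, (∃ r : R, r ≠ 0 ∧ algebraMap R _ r ∈ J) ∨ del Q j b = 0) →
        ∃ r : R, r ≠ 0 ∧ algebraMap R _ r ∈ J := by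
      intro b hb hb0 h
      by_contra hcon
      exact hcon (base b (fun j => (h j).resolve_left hcon) hb hb0)
    intro m
    induction m with
    | zero =>
      intro b hb hbJ hb0
      refine step b hbJ hb0 fun j => ?_
      by_cases hj : del Q j b = 0
      · exact .inr hj
      left
      refine base ((gram Q).det • del Q j b) ?_ (hdel j b hbJ)
        (fun h => hj (smul_left_cancel Q hQ (by simpa using h)))
      obtain ⟨b₀, hb₀, b₁, hb₁, rfl⟩ := Submodule.mem_sup.1 hb
      intro l
      rw [map_smul, map_add, map_add, del_of_mem_wordSpan_zero Q j hb₀,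
        del_of_mem_wordSpan_zero Q l (del_mem_wordSpan Q j hb₁)]
      simp
    | succ m ih =>
      intro b hb hbJ hb0
      refine step b hbJ hb0 fun j => ?_
      by_cases hj : del Q j b = 0
      · exact .inr hj
      left
      refine ih ((gram Q).det • del Q j b) (Submodule.smul_mem _ _ ?_) (hdel j b hbJ)
        (fun h => hj (smul_left_cancel Q hQ (by simpa using h)))
      obtain ⟨b₀, hb₀, b₁, hb₁, rfl⟩ := Submodule.mem_sup.1 hb
      rw [map_add]
      exact Submodule.add_mem_sup (del_mem_wordSpan Q j hb₀) (del_mem_wordSpan Q j hb₁)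
  obtain ⟨m, b₀, hb₀, b₁, hb₁, rfl⟩ := exists_mem_wordSpan_add Q b
  exact key (2 * m) _ (Submodule.add_mem_sup hb₀ hb₁) hb hb0

end Center

/-! ### Universal property for homomorphisms that change the scalars -/

section Lift

variable {R : Type*} [CommRing R] {n : ℕ} (Q : QuadraticForm R (Fin n → R))

theorem ringHom_ext_gen {S : Type*} [Ring S] {f g : CliffordAlgebra Q →+* S}
    (h : ∀ r, f (algebraMap R _ r) = g (algebraMap R _ r)) (h' : ∀ i, f (gen Q i) = g (gen Q i)) :
    f = g := by
  ext a
  induction a using CliffordAlgebra.induction with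
  | algebraMap r => exact h r
  | ι v => simp only [ι_eq_sum, map_sum, Algebra.smul_def, map_mul, h, h']
  | mul a b ha hb => rw [map_mul, map_mul, ha, hb]
  | add a b ha hb => rw [map_add, map_add, ha, hb]

theorem exists_ringHom [Algebra ℚ R] {S : Type*} [Ring S] (φ : R →+* S)
    (hφ : ∀ r s, φ r * s = s * φ r) (X : Fin n → S)
    (hX : ∀ i j, X i * X j + X j * X i = φ (gram Q i j)) :
    ∃ Φ : CliffordAlgebra Q →+* S, (∀ r, Φ (algebraMap R _ r) = φ r) ∧
      ∀ i, Φ (gen Q i) = X i := by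
  -- Central images make the target an R-algebra through φ, so the usual lift applies.
  let := φ.toAlgebra' hφ
  have halg : ∀ r, algebraMap R S r = φ r := fun r => rfl
  let f : (Fin n → R) →ₗ[R] S := ∑ i, (LinearMap.proj i : (Fin n → R) →ₗ[R] R).smulRight (X i)
  have hf : ∀ i, f (Pi.single i 1) = X i := by
    intro i
    simp [f, Pi.single_apply, ite_smul]
  have h2 : IsUnit (2 : S) := by
    have := (isUnit_intCast (R := R) (show (2 : ℤ) ≠ 0 by norm_num)).map φ
    rwa [map_intCast, Int.cast_ofNat] at this
  have cond : ∀ v, f v * f v = algebraMap R S (Q v) := by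
    rw [forall_mul_self_eq_iff h2]
    refine LinearMap.pi_ext' fun i => LinearMap.ext_ring <| LinearMap.pi_ext' fun j =>
      LinearMap.ext_ring ?_
    change f (Pi.single i 1) * f (Pi.single j 1) + f (Pi.single j 1) * f (Pi.single i 1) =
      φ (gram Q i j)
    rw [hf, hf, hX]
  refine ⟨(lift Q ⟨f, cond⟩ : CliffordAlgebra Q →+* S), fun r => ?_, fun i => ?_⟩
  · exact (lift Q ⟨f, cond⟩).commutes r
  · exact (lift_ι_apply f cond (Pi.single i 1)).trans (hf i)

theorem gram_toQuadraticForm' (M : Matrix (Fin n) (Fin n) R) (i j : Fin n) :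
    gram M.toQuadraticForm' i j = M i j + M j i := by
  rw [gram, Matrix.of_apply, Matrix.toQuadraticForm', LinearMap.BilinMap.polar_toQuadraticMap,
    Matrix.toLinearMap₂'_apply', Matrix.toLinearMap₂'_apply']
  simp

end Lift

/-! ### Sums of squares and polynomials with coefficients on sign lines -/

section Lines

variable (k : Type*) [Field k] (n : ℕ)

/-- The sum of squares in `n` variables. -/
noncomputable abbrev sumSq : QuadraticForm k (Fin n → k) :=
  (1 : Matrix (Fin n) (Fin n) k).toQuadraticForm'

theorem gram_sumSq (i j : Fin n) : gram (sumSq k n) i j = if i = j then 2 else 0 := by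
  rw [gram_toQuadraticForm']
  by_cases h : i = j
  · subst h; simp; norm_num
  · simp [h, Ne.symm h]

theorem det_gram_sumSq [CharZero k] : (gram (sumSq k n)).det ≠ 0 := by
  have : gram (sumSq k n) = Matrix.diagonal fun _ => 2 := by
    ext i j; rw [gram_sumSq, Matrix.diagonal_apply]
  rw [this, Matrix.det_diagonal]
  simp

theorem gen_sumSq_mul_self [CharZero k] (i : Fin n) : gen (sumSq k n) i * gen (sumSq k n) i = 1 := by
  have h := gen_mul_gen_add (sumSq k n) i i
  rw [gram_sumSq, if_pos rfl, ← two_smul k, Algebra.algebraMap_eq_smul_one] at h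
  exact smul_left_cancel _ two_ne_zero h

theorem gen_sumSq_anticomm {i j : Fin n} (hij : i ≠ j) :
    gen (sumSq k n) i * gen (sumSq k n) j = -(gen (sumSq k n) j * gen (sumSq k n) i) := by
  have h := gen_mul_gen_add (sumSq k n) i j
  rw [gram_sumSq, if_neg hij, map_zero] at h
  exact eq_neg_of_add_eq_zero_left h

/-- Index set of the auxiliary central variables: the entries `u_(i,m)` of a matrix and the
square roots `s_m` of diagonal entries. -/
abbrev AuxVar : Type := (Fin n × Fin n) ⊕ Fin n

variable {n} in
/-- The number of generators other than the `i`-th, with multiplicity, in an exponent. -/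
noncomputable def signExp (i : Fin n) : (AuxVar n →₀ ℕ) →+ ℕ :=
  ∑ j ∈ Finset.univ.erase i, Finsupp.applyAddHom (Sum.inr j)

/-- The simultaneous eigenspace of the conjugations by the generators that contains the ordered
monomial with exponent `a`. -/
noncomputable def signLine (a : AuxVar n →₀ ℕ) : Submodule k (CliffordAlgebra (sumSq k n)) where
  carrier := {c | ∀ i, gen _ i * c = (-1 : k) ^ signExp i a • (c * gen _ i)}
  add_mem' ha hb i := by rw [mul_add, ha i, hb i, add_mul, smul_add]
  zero_mem' i := by simp
  smul_mem' r c hc i := by rw [mul_smul_comm, hc i, smul_mul_assoc, smul_comm]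

variable {k n}

theorem one_mem_signLine {a : AuxVar n →₀ ℕ} (ha : ∀ i, Even (signExp i a)) :
    (1 : CliffordAlgebra (sumSq k n)) ∈ signLine k n a := by
  intro i
  simp [(ha i).neg_one_pow]

theorem mul_mem_signLine {a b : AuxVar n →₀ ℕ} {c d : CliffordAlgebra (sumSq k n)}
    (hc : c ∈ signLine k n a) (hd : d ∈ signLine k n b) : c * d ∈ signLine k n (a + b) := by
  intro i
  rw [← mul_assoc, hc i, smul_mul_assoc, mul_assoc, hd i, mul_smul_comm, smul_smul, map_add,
    pow_add, mul_assoc]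

theorem signExp_single_inr (i m : Fin n) :
    signExp i (Finsupp.single (Sum.inr m) 1) = if m = i then 0 else 1 := by
  simp [signExp, Finsupp.single_apply, eq_comm]

theorem signExp_single_inl (i : Fin n) (p : Fin n × Fin n) (l : ℕ) :
    signExp i (Finsupp.single (Sum.inl p) l) = 0 := by
  simp [signExp]

theorem gen_mem_signLine (m : Fin n) :
    gen (sumSq k n) m ∈ signLine k n (Finsupp.single (Sum.inr m) 1) := by
  intro i
  rw [signExp_single_inr]
  by_cases h : m = i
  · subst h; simp
  · simp [h, gen_sumSq_anticomm k n (Ne.symm h)]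

theorem isUnit_gen_sumSq [CharZero k] (m : Fin n) : IsUnit (gen (sumSq k n) m) :=
  ⟨⟨_, _, gen_sumSq_mul_self k n m, gen_sumSq_mul_self k n m⟩, rfl⟩

theorem exists_isUnit_mem_signLine [CharZero k] (a : AuxVar n →₀ ℕ) : ∃ u ∈ signLine k n a, IsUnit u := by
  induction a using Finsupp.induction_linear with
  | zero => exact ⟨1, one_mem_signLine (by simp), isUnit_one⟩
  | add a b ha hb =>
    obtain ⟨u, hu, hu'⟩ := ha
    obtain ⟨v, hv, hv'⟩ := hb
    exact ⟨u * v, mul_mem_signLine hu hv, hu'.mul hv'⟩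
  | single x l =>
    rcases x with p | m
    · exact ⟨1, one_mem_signLine (by simp [signExp_single_inl]), isUnit_one⟩
    · induction l with
      | zero => exact ⟨1, one_mem_signLine (by simp), isUnit_one⟩
      | succ l ih =>
        obtain ⟨u, hu, hu'⟩ := ih
        refine ⟨u * gen _ m, ?_, hu'.mul (isUnit_gen_sumSq m)⟩
        rw [Finsupp.single_add]
        exact mul_mem_signLine hu (gen_mem_signLine m)

/-- Multiplying c by a unit of the same line doubles all signs, so the product commutes with every
generator and is a scalar, nonzero because c is. -/
theorem isUnit_of_mem_signLine [CharZero k] (hn : Even n) {a : AuxVar n →₀ ℕ}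
    {c : CliffordAlgebra (sumSq k n)} (hc : c ∈ signLine k n a) (hc0 : c ≠ 0) : IsUnit c := by
  obtain ⟨u, hu, hu'⟩ := exists_isUnit_mem_signLine (k := k) a
  have h : c * u ∈ Set.range (algebraMap k (CliffordAlgebra (sumSq k n))) := by
    refine mem_range_of_commute_gen _ hn (det_gram_sumSq k n) fun i => ?_
    rw [mul_mem_signLine hc hu i, map_add, (Even.add_self _).neg_one_pow, one_smul]
  obtain ⟨r, hr⟩ := h
  have hr0 : r ≠ 0 := by
    rintro rfl
    rw [map_zero] at hr
    exact hc0 (hu'.mul_left_eq_zero.1 hr.symm)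
  exact (hu'.mul_right_iff).1 (hr ▸ (IsUnit.mk0 r hr0).map _)

/-- The property of having each coefficient on the sign line of its exponent. -/
def IsSigned (y : AddMonoidAlgebra (CliffordAlgebra (sumSq k n)) (AuxVar n →₀ ℕ)) : Prop :=
  ∀ a, y.coeff a ∈ signLine k n a

theorem IsSigned.add {y z : AddMonoidAlgebra (CliffordAlgebra (sumSq k n)) (AuxVar n →₀ ℕ)}
    (hy : IsSigned y) (hz : IsSigned z) : IsSigned (y + z) := fun a => by
  simpa using add_mem (hy a) (hz a)

theorem IsSigned.mul {y z : AddMonoidAlgebra (CliffordAlgebra (sumSq k n)) (AuxVar n →₀ ℕ)}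
    (hy : IsSigned y) (hz : IsSigned z) : IsSigned (y * z) := fun a => by
  classical
  rw [AddMonoidAlgebra.coeff_mul]
  refine sum_mem fun b _ => sum_mem fun c _ => ?_
  dsimp only
  split_ifs with h
  · exact h ▸ mul_mem_signLine (hy b) (hz c)
  · exact zero_mem _

theorem isSigned_single {a : AuxVar n →₀ ℕ} {c : CliffordAlgebra (sumSq k n)}
    (hc : c ∈ signLine k n a) : IsSigned (AddMonoidAlgebra.single a c) := fun b => by
  classical
  rw [AddMonoidAlgebra.coeff_single, Finsupp.single_apply]
  split_ifs with h
  · exact h ▸ hc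
  · exact zero_mem _

theorem isSigned_sum {κ : Type*} (s : Finset κ)
    (f : κ → AddMonoidAlgebra (CliffordAlgebra (sumSq k n)) (AuxVar n →₀ ℕ))
    (h : ∀ x ∈ s, IsSigned (f x)) : IsSigned (∑ x ∈ s, f x) := by
  classical
  induction s using Finset.induction_on with
  | empty => intro a; simp
  | insert x s hx ih =>
    rw [Finset.sum_insert hx]
    exact (h x (by simp)).add (ih fun y hy => h y (by simp [hy]))

/-- Some exponent of the product arises from exactly one pair of exponents; its coefficient is a
unit from y times a nonzero element. -/
theorem IsSigned.mul_ne_zero [CharZero k] (hn : Even n)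
    {y z : AddMonoidAlgebra (CliffordAlgebra (sumSq k n)) (AuxVar n →₀ ℕ)}
    (hy : IsSigned y) (hy0 : y ≠ 0) (hz0 : z ≠ 0) : y * z ≠ 0 := by
  simp only [ne_eq, ← AddMonoidAlgebra.coeff_eq_zero, ← Finsupp.support_nonempty_iff] at hy0 hz0
  obtain ⟨a, ha, b, hb, h⟩ := UniqueSums.uniqueAdd_of_nonempty hy0 hz0
  rw [Finsupp.mem_support_iff] at ha hb
  intro h0
  have h1 := AddMonoidAlgebra.coeff_mul_add_of_uniqueAdd h
  rw [h0] at h1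
  exact hb ((isUnit_of_mem_signLine hn (hy a) ha).mul_right_eq_zero.1 (by simpa using h1.symm))

end Lines

end CliffordAlgebra

namespace GenericClifford

open CliffordAlgebra MvPolynomial

/-! ### The generic Clifford algebra is a domain -/

section Generic

variable (k : Type*) [Field k] (n : ℕ)

theorem gram_genericForm (i j : Fin n) :
    gram (genericForm k n) i j = 2 * MvPolynomial.X s(i, j) := by
  have h := gram_toQuadraticForm' (genericMatrix k n) i j
  rw [genericForm, h, genericMatrix, Matrix.of_apply, Matrix.of_apply, Sym2.eq_swap, two_mul]

theorem x_eq_gen (i : Fin n) : x k n i = gen (genericForm k n) i := rfl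

theorem x_mul_x_add (i j : Fin n) : x k n i * x k n j + x k n j * x k n i =
    algebraMap (BaseRing k n) (Alg k n) (2 * MvPolynomial.X s(i, j)) := by
  rw [x_eq_gen, x_eq_gen, gen_mul_gen_add, gram_genericForm]

theorem det_gram_genericForm [CharZero k] : (gram (genericForm k n)).det ≠ 0 := by
  classical
  intro h
  have h1 := congrArg (MvPolynomial.eval fun p : Sym2 (Fin n) => if p.IsDiag then (1 : k) else 0) h
  rw [RingHom.map_det, map_zero] at h1
  have h2 : (MvPolynomial.eval fun p : Sym2 (Fin n) => if p.IsDiag then (1 : k) else 0).mapMatrix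
      (gram (genericForm k n)) = Matrix.diagonal fun _ => 2 := by
    ext i j
    simp [gram_genericForm, Matrix.diagonal_apply]
  rw [h2, Matrix.det_diagonal] at h1
  simp at h1

/-- The entry `∑ m, u_(i,m) u_(j,m) s_m ^ 2` of the matrix `U S² Uᵀ`. -/
noncomputable def diagEntry : Sym2 (Fin n) → MvPolynomial (AuxVar n) k :=
  Sym2.lift ⟨fun i j => ∑ m, X (Sum.inl (i, m)) * X (Sum.inl (j, m)) * X (Sum.inr m) ^ 2,
    fun i j => Finset.sum_congr rfl fun m _ => by rw [mul_comm (X (Sum.inl (i, m)))]⟩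

/-- Every symmetric matrix over k is diagonalised by an orthogonal basis, and the diagonal entries
have square roots in the algebraic closure. So a polynomial in the kernel vanishes at every k-point.
-/
theorem aeval_diagEntry_injective [CharZero k] :
    Function.Injective (aeval (diagEntry k n) : BaseRing k n →ₐ[k] MvPolynomial (AuxVar n) k) := by
  rw [injective_iff_map_eq_zero]
  intro f hf
  refine MvPolynomial.funext fun t₀ => ?_
  rw [map_zero]
  let : Invertible (2 : k) := invertibleOfNonzero two_ne_zero
  let M₀ : Matrix (Fin n) (Fin n) k := Matrix.of fun i j => t₀ s(i, j)
  let β : LinearMap.BilinForm k (Fin n → k) := Matrix.toBilin' M₀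
  have hβ : LinearMap.IsSymm β := by
    refine ⟨fun a b => ?_⟩
    simp only [β, Matrix.toBilin'_apply, RingHom.id_apply]
    rw [Finset.sum_comm]
    refine Finset.sum_congr rfl fun i _ => Finset.sum_congr rfl fun j _ => ?_
    simp only [M₀, Matrix.of_apply]
    rw [Sym2.eq_swap]
    ring
  obtain ⟨v, hv⟩ := LinearMap.BilinForm.exists_orthogonal_basis hβ
  let e : Fin (Module.finrank k (Fin n → k)) ≃ Fin n := finCongr (by simp)
  let w := v.reindex e
  have hw : ∀ a b, a ≠ b → β (w a) (w b) = 0 := by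
    intro a b hab
    simp only [w, Module.Basis.reindex_apply]
    exact hv (fun h => hab (e.symm.injective h))
  let K := AlgebraicClosure k
  have hsq : ∀ m, ∃ s : K, s ^ 2 = algebraMap k K (β (w m) (w m)) := fun m =>
    IsAlgClosed.exists_pow_nat_eq _ two_pos
  choose s hs using hsq
  -- u_(i,m) is the m-th coordinate of e_i in the orthogonal basis, and s_m is a square root of the
  -- form at w_m.
  let pt : AuxVar n → K := Sum.elim (fun p => algebraMap k K (w.repr (Pi.single p.1 1) p.2)) s
  have hpt : ∀ p, aeval pt (diagEntry k n p) = algebraMap k K (t₀ p) := by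
    intro p
    induction p using Sym2.ind with
    | _ i j =>
      have h1 : t₀ s(i, j) = β (Pi.single i 1) (Pi.single j 1) := by
        simp [β, M₀]
      rw [h1, ← w.sum_repr (Pi.single i 1), ← w.sum_repr (Pi.single j 1)]
      simp only [map_sum, LinearMap.sum_apply, map_smul, LinearMap.smul_apply, smul_eq_mul]
      simp only [diagEntry, Sym2.lift_mk, map_sum, map_mul, map_pow, aeval_X, pt, Sum.elim_inl,
        Sum.elim_inr, hs]
      refine Finset.sum_congr rfl fun m _ => ?_
      rw [Finset.sum_eq_single m (fun l _ hl => by rw [hw _ _ hl]; simp) (by simp)]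
      ring
  have h := congrArg (aeval pt) hf
  rw [map_zero, ← AlgHom.comp_apply, comp_aeval] at h
  simp only [hpt] at h
  rw [show (fun p => algebraMap k K (t₀ p)) = algebraMap k K ∘ t₀ from rfl,
    MvPolynomial.aeval_algebraMap_apply] at h
  simpa using h

/-- The coefficient ring of the model: polynomials in the auxiliary variables over the Clifford
algebra of a sum of squares. -/
abbrev Model : Type _ := AddMonoidAlgebra (CliffordAlgebra (sumSq k n)) (AuxVar n →₀ ℕ)

/-- The images `∑ m, u_(i,m) s_m γ_m` of the generators in the model. -/
noncomputable def modelGen (i : Fin n) : Model k n :=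
  ∑ m, AddMonoidAlgebra.single (Finsupp.single (Sum.inl (i, m)) 1 + Finsupp.single (Sum.inr m) 1)
    (gen (sumSq k n) m)

/-- The embedding of `T_g` in the model. -/
noncomputable def modelBase : BaseRing k n →+* Model k n :=
  (AddMonoidAlgebra.mapRingHom _ (algebraMap k (CliffordAlgebra (sumSq k n)))).comp
    (aeval (diagEntry k n) : BaseRing k n →ₐ[k] MvPolynomial (AuxVar n) k).toRingHom

theorem modelBase_injective [CharZero k] : Function.Injective (modelBase k n) := by
  refine Function.Injective.comp (g := AddMonoidAlgebra.mapRingHom _ _) ?_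
    (aeval_diagEntry_injective k n)
  intro p q h
  apply AddMonoidAlgebra.ext
  ext a
  have := congrArg (fun y => y.coeff a) h
  simp only [AddMonoidAlgebra.coeff_mapRingHom] at this
  exact CliffordAlgebra.algebraMap_injective _ this

theorem mapRingHom_algebraMap_commute (p : MvPolynomial (AuxVar n) k) (y : Model k n) :
    AddMonoidAlgebra.mapRingHom _ (algebraMap k (CliffordAlgebra (sumSq k n))) p * y =
      y * AddMonoidAlgebra.mapRingHom _ (algebraMap k (CliffordAlgebra (sumSq k n))) p := by
  induction p using AddMonoidAlgebra.induction_linear with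
  | zero => simp
  | add p q hp hq => rw [map_add, add_mul, mul_add, hp, hq]
  | single a r =>
    rw [AddMonoidAlgebra.mapRingHom_single]
    induction y using AddMonoidAlgebra.induction_linear with
    | zero => simp
    | add y z hy hz => rw [add_mul, mul_add, hy, hz]
    | single b c =>
      rw [AddMonoidAlgebra.single_mul_single, AddMonoidAlgebra.single_mul_single, add_comm,
        Algebra.commutes]

theorem modelBase_X (i j : Fin n) : modelBase k n (X s(i, j)) =
    ∑ m, AddMonoidAlgebra.single (Finsupp.single (Sum.inl (i, m)) 1 +
      Finsupp.single (Sum.inl (j, m)) 1 + Finsupp.single (Sum.inr m) 2) 1 := by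
  simp only [modelBase, RingHom.comp_apply, AlgHom.toRingHom_eq_coe, RingHom.coe_coe, aeval_X,
    diagEntry, Sym2.lift_mk, map_sum]
  refine Finset.sum_congr rfl fun m _ => ?_
  rw [show (X (Sum.inl (i, m)) * X (Sum.inl (j, m)) * X (Sum.inr m) ^ 2 :
    MvPolynomial (AuxVar n) k) = AddMonoidAlgebra.single (Finsupp.single (Sum.inl (i, m)) 1 +
      Finsupp.single (Sum.inl (j, m)) 1 + Finsupp.single (Sum.inr m) 2) 1 from ?_]
  · rw [AddMonoidAlgebra.mapRingHom_single, map_one]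
  · simp only [X, monomial_pow, monomial_mul]
    simp
    rfl

/-- Cross terms cancel because distinct γ_l anticommute; the diagonal terms use γ_m^2 = 1. -/
theorem modelGen_mul_add [CharZero k] (i j : Fin n) :
    modelGen k n i * modelGen k n j + modelGen k n j * modelGen k n i =
      modelBase k n (gram (genericForm k n) i j) := by
  rw [gram_genericForm, two_mul, map_add, modelBase_X]
  simp only [modelGen, Finset.sum_mul_sum, AddMonoidAlgebra.single_mul_single]
  rw [Finset.sum_comm (f := fun a b => AddMonoidAlgebra.single (Finsupp.single (Sum.inl (j, a)) 1 +
    Finsupp.single (Sum.inr a) 1 + (Finsupp.single (Sum.inl (i, b)) 1 +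
    Finsupp.single (Sum.inr b) 1)) (gen (sumSq k n) a * gen (sumSq k n) b)),
    ← Finset.sum_add_distrib, ← Finset.sum_add_distrib]
  refine Finset.sum_congr rfl fun m _ => ?_
  rw [← Finset.sum_add_distrib, Finset.sum_eq_single m]
  · rw [gen_sumSq_mul_self]
    have e : (Finsupp.single (Sum.inr m) 2 : AuxVar n →₀ ℕ) =
      Finsupp.single (Sum.inr m) 1 + Finsupp.single (Sum.inr m) 1 := by
      rw [← Finsupp.single_add]
    rw [e]
    congr 2 <;> abel
  · intro l _ hl
    rw [gen_sumSq_anticomm k n hl, add_comm (Finsupp.single (Sum.inl (j, l)) 1 + _),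
      ← AddMonoidAlgebra.single_add, add_neg_cancel, AddMonoidAlgebra.single_zero]
  · simp

theorem isSigned_modelBase (f : BaseRing k n) : IsSigned (modelBase k n f) := by
  induction f using MvPolynomial.induction_on with
  | C r =>
    have e : modelBase k n (C r) = AddMonoidAlgebra.single 0 (algebraMap k _ r) := by
      simp only [modelBase, RingHom.comp_apply, AlgHom.toRingHom_eq_coe, RingHom.coe_coe, aeval_C]
      exact AddMonoidAlgebra.mapRingHom_single _ _ _
    rw [e, Algebra.algebraMap_eq_smul_one]
    exact isSigned_single (Submodule.smul_mem _ _ (one_mem_signLine (by simp)))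
  | add p q hp hq => rw [map_add]; exact hp.add hq
  | mul_X p a hp =>
    rw [map_mul]
    refine hp.mul ?_
    induction a using Sym2.ind with
    | _ i j =>
      rw [modelBase_X]
      refine isSigned_sum _ _ fun m _ => isSigned_single (one_mem_signLine fun l => ?_)
      rw [map_add, map_add, signExp_single_inl, signExp_single_inl,
        show (Finsupp.single (Sum.inr m) 2 : AuxVar n →₀ ℕ) =
        Finsupp.single (Sum.inr m) 1 + Finsupp.single (Sum.inr m) 1 by rw [← Finsupp.single_add],
        map_add]
      simp

theorem isSigned_modelGen (i : Fin n) : IsSigned (modelGen k n i) := by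
  refine isSigned_sum _ _ fun m _ => isSigned_single ?_
  rw [← one_mul (gen _ m)]
  exact mul_mem_signLine (one_mem_signLine (by simp [signExp_single_inl])) (gen_mem_signLine m)

/-- The kernel of the map Ψ to the model is an ideal stable under the involution. If nonzero it
would contain a nonzero scalar, but Ψ is injective on T. Images are signed, so their products do not
vanish. -/
theorem noZeroDivisors_alg [CharZero k] (hn : Even n) : NoZeroDivisors (Alg k n) := by
  obtain ⟨Ψ, hT, hx⟩ := exists_ringHom (genericForm k n) (modelBase k n)
    (fun f y => mapRingHom_algebraMap_commute k n _ y) (modelGen k n)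
    (modelGen_mul_add k n)
  have hsign : ∀ a, IsSigned (Ψ a) := by
    intro a
    induction a using CliffordAlgebra.induction with
    | algebraMap f => rw [hT]; exact isSigned_modelBase k n f
    | ι v =>
      rw [ι_eq_sum, map_sum]
      refine isSigned_sum _ _ fun i _ => ?_
      rw [Algebra.smul_def, map_mul, hT, hx]
      exact (isSigned_modelBase k n _).mul (isSigned_modelGen k n i)
    | mul a b ha hb => rw [map_mul]; exact ha.mul hb
    | add a b ha hb => rw [map_add]; exact ha.add hb
  let inv : Model k n →+* Model k n := AddMonoidAlgebra.mapRingHom _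
    (involute : CliffordAlgebra (sumSq k n) →ₐ[k] CliffordAlgebra (sumSq k n)).toRingHom
  have hinv : ∀ a, Ψ (involute a) = inv (Ψ a) := by
    have : Ψ.comp (involute : Alg k n →ₐ[BaseRing k n] Alg k n).toRingHom = inv.comp Ψ := by
      refine ringHom_ext_gen _ (fun f => ?_) fun i => ?_
      · simp only [RingHom.comp_apply, AlgHom.toRingHom_eq_coe, RingHom.coe_coe,
          AlgHom.commutes, hT, modelBase, inv]
        generalize (aeval (diagEntry k n)) f = p
        induction p using AddMonoidAlgebra.induction_linear with
        | zero => simp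
        | add p q hp hq => simp only [map_add] at *; rw [← hp, ← hq]
        | single a r => simp
      · simp only [RingHom.comp_apply, AlgHom.toRingHom_eq_coe, RingHom.coe_coe,
          involute_gen, map_neg, hx, modelGen, map_sum, inv, AddMonoidAlgebra.mapRingHom_single,
          AddMonoidAlgebra.single_neg, Finset.sum_neg_distrib]
    exact fun a => RingHom.congr_fun this a
  let J : Submodule (BaseRing k n) (Alg k n) :=
    { carrier := {a | Ψ a = 0}
      add_mem' := fun {a b} ha hb => by
        simp only [Set.mem_ofPred_eq] at *
        rw [map_add, ha, hb, add_zero]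
      zero_mem' := map_zero Ψ
      smul_mem' := fun f a ha => by
        simp only [Set.mem_ofPred_eq] at *
        rw [Algebra.smul_def, map_mul, ha, mul_zero] }
  have hΨ : ∀ a, a ≠ 0 → Ψ a ≠ 0 := by
    intro a ha h
    obtain ⟨f, hf, hfJ⟩ := exists_scalar_mem (genericForm k n) (det_gram_genericForm k n) J
      (fun i a (ha : Ψ a = 0) => show Ψ _ = 0 by rw [map_mul, ha, mul_zero])
      (fun i a (ha : Ψ a = 0) => show Ψ _ = 0 by rw [map_mul, ha, zero_mul])
      (fun a (ha : Ψ a = 0) => show Ψ _ = 0 by rw [hinv, ha, map_zero]) (b := a) h ha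
    have h0 : Ψ (algebraMap _ _ f) = 0 := hfJ
    rw [hT] at h0
    exact hf (modelBase_injective k n (by rw [h0, map_zero]))
  refine ⟨fun {a b} hab => ?_⟩
  by_contra! hcon
  refine (hsign a).mul_ne_zero hn (hΨ a hcon.1) (hΨ b hcon.2) ?_
  rw [← map_mul, hab, map_zero]

end Generic

/-- With indices counted from 0, m is the smaller member of n - m pairs and the larger member of m +
1, the diagonal pair counting in both. -/
theorem prod_sym2_map_mul {M : Type*} [CommMonoid M] {n : ℕ} (d : Fin n → M) :
    ∏ p : Sym2 (Fin n), (p.map d).mul = (∏ m, d m) ^ (n + 1) := by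
  have e : ∏ p : Sym2 (Fin n), (p.map d).mul =
      ∏ q : {q : Fin n × Fin n // q.1 ≤ q.2}, d q.1.1 * d q.1.2 := by
    refine Fintype.prod_equiv Sym2.sortEquiv _ _ fun p => ?_
    obtain ⟨q, rfl⟩ := Sym2.sortEquiv.symm.surjective p
    rw [Equiv.apply_symm_apply]
    rfl
  have e' : ∏ q : {q : Fin n × Fin n // q.1 ≤ q.2}, d q.1.1 * d q.1.2 =
      ∏ i, ∏ j, if i ≤ j then d i * d j else 1 := by
    rw [← Finset.prod_product', Finset.univ_product_univ, ← Finset.prod_filter]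
    exact (Finset.prod_subtype (p := fun q : Fin n × Fin n => q.1 ≤ q.2) _ (by simp)
      fun q : Fin n × Fin n => d q.1 * d q.2).symm
  have h1 : ∀ i : Fin n, ∏ j, (if i ≤ j then d i else 1) = d i ^ (n - i) := fun i => by
    rw [← Finset.prod_filter, Finset.prod_const, Finset.filter_le_eq_Ici, Fin.card_Ici]
  have h2 : ∀ j : Fin n, ∏ i, (if i ≤ j then d j else 1) = d j ^ (j + 1 : ℕ) := fun j => by
    rw [← Finset.prod_filter, Finset.prod_const, Finset.filter_ge_eq_Iic, Fin.card_Iic]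
  have h3 : ∀ i j : Fin n, (if i ≤ j then d i * d j else 1) =
      (if i ≤ j then d i else 1) * if i ≤ j then d j else 1 := fun i j => by
    split_ifs <;> simp
  rw [e, e']
  simp only [h3, Finset.prod_mul_distrib, h1]
  rw [Finset.prod_comm]
  simp only [h2, ← Finset.prod_mul_distrib, ← pow_add]
  rw [← Finset.prod_pow]
  exact Finset.prod_congr rfl fun i _ => by congr 1; omega

/-! ### Automorphisms from the monomial group -/

section MonomialAut

variable {k : Type*} [Field k] {n : ℕ}

theorem algebraMap_mem_B (r : ℕ) (f : BaseRing k n) :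
    algebraMap (BaseRing k n) (Alg k n) f ∈ B k n r := by
  induction f using MvPolynomial.induction_on with
  | C c =>
    rw [← MvPolynomial.algebraMap_eq, ← IsScalarTower.algebraMap_apply]
    exact (B k n r).algebraMap_mem c
  | add p q hp hq => rw [map_add]; exact add_mem hp hq
  | mul_X p a hp =>
    rw [map_mul]
    refine mul_mem hp ?_
    induction a using Sym2.ind with
    | _ i j => exact Algebra.subset_adjoin (Or.inl ⟨i, j, rfl⟩)

theorem algHom_B_ext {r : ℕ} {S : Type*} [Semiring S] [Algebra k S] {f g : B k n r →ₐ[k] S}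
    (ht : ∀ i j, f (tB k n r i j) = g (tB k n r i j)) (hz : ∀ i, f (zB k n r i) = g (zB k n r i)) :
    f = g := by
  refine AlgHom.ext fun b => ?_
  obtain ⟨b, hb⟩ := b
  induction hb using Algebra.adjoin_induction with
  | mem a h =>
    rcases h with ⟨i, j, rfl⟩ | ⟨i, rfl⟩
    · exact ht i j
    · exact hz i
  | algebraMap c => exact (f.commutes c).trans (g.commutes c).symm
  | add a b ha hb ha' hb' =>
    have : (⟨a + b, add_mem ha hb⟩ : B k n r) = ⟨a, ha⟩ + ⟨b, hb⟩ := rfl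
    rw [this, map_add, map_add, ha', hb']
  | mul a b ha hb ha' hb' =>
    have : (⟨a * b, mul_mem ha hb⟩ : B k n r) = ⟨a, ha⟩ * ⟨b, hb⟩ := rfl
    rw [this, map_mul, map_mul, ha', hb']

theorem algebraMap_smul_base (c : k) (f : BaseRing k n) :
    algebraMap (BaseRing k n) (Alg k n) (c • f) = c • algebraMap (BaseRing k n) (Alg k n) f :=
  map_smul (IsScalarTower.toAlgHom k (BaseRing k n) (Alg k n)) c f

/-- The substitution `t_(i,j) ↦ d_(σ i) d_(σ j) t_(σ i, σ j)` of the base ring. -/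
noncomputable def baseSubst (d : Fin n → k) (σ : Equiv.Perm (Fin n)) :
    BaseRing k n →ₐ[k] BaseRing k n :=
  aeval fun p => ((p.map σ).map d).mul • X (p.map σ)

theorem baseSubst_X (d : Fin n → k) (σ : Equiv.Perm (Fin n)) (i j : Fin n) :
    baseSubst d σ (X s(i, j)) = (d (σ i) * d (σ j)) • X s(σ i, σ j) := by
  simp [baseSubst]

theorem baseSubst_tProd (d : Fin n → k) (σ : Equiv.Perm (Fin n)) :
    baseSubst d σ (tProd k n) = ((∏ m, d m) ^ (n + 1)) • tProd k n := by
  simp only [tProd, map_prod, baseSubst, aeval_X]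
  rw [Finset.prod_smul, ← prod_sym2_map_mul]
  have hσ : Function.Bijective (Sym2.map σ) :=
    Finite.injective_iff_bijective.1 (Sym2.map.injective σ.injective)
  congr 1
  · exact Fintype.prod_bijective _ hσ _ _ fun p => rfl
  · exact Fintype.prod_bijective _ hσ _ _ fun p => rfl

theorem baseSubst_monomial (d : Fin n → k) (σ : Equiv.Perm (Fin n)) (α : Sym2 (Fin n) →₀ ℕ) :
    ∃ (c : k) (β : Sym2 (Fin n) →₀ ℕ), β.degree = α.degree ∧
      baseSubst d σ (monomial α 1) = c • monomial β 1 := by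
  induction α using Finsupp.induction_linear with
  | zero => exact ⟨1, 0, rfl, by simp [← C_apply]⟩
  | add a b ha hb =>
    obtain ⟨c, α, h1, h2⟩ := ha
    obtain ⟨c', α', h1', h2'⟩ := hb
    refine ⟨c * c', α + α', by simp [h1, h1'], ?_⟩
    rw [← one_mul (1 : k), ← monomial_mul, map_mul, h2, h2', smul_mul_smul_comm, monomial_mul]
  | single p e =>
    refine ⟨((p.map σ).map d).mul ^ e, Finsupp.single (p.map σ) e, by simp, ?_⟩
    have h : ∀ q : Sym2 (Fin n), monomial (Finsupp.single q e) (1 : k) = X q ^ e := fun q =>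
      (MvPolynomial.X_pow_eq_monomial).symm
    rw [h, h, map_pow, baseSubst, aeval_X, smul_pow]

theorem map_piece_le {d : Fin n → k} {σ : Equiv.Perm (Fin n)} {Φ : Alg k n →ₐ[k] Alg k n}
    (h1 : ∀ f, Φ (algebraMap (BaseRing k n) _ f) =
      algebraMap (BaseRing k n) _ (baseSubst d σ f))
    (h2 : ∀ i, Φ (x k n i) = d (σ i) • x k n (σ i)) (m : ℕ) {a : Alg k n}
    (ha : a ∈ piece k n m) : Φ a ∈ piece k n m := by
  induction ha using Submodule.span_induction with
  | mem a h =>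
    obtain ⟨α, w, h, rfl⟩ := h
    have hw : ∃ (c : k) (w' : List (Fin n)), w'.length = w.length ∧
        Φ (w.map (x k n)).prod = c • (w'.map (x k n)).prod := by
      clear h
      induction w with
      | nil => exact ⟨1, [], rfl, by simp⟩
      | cons i w ih =>
        obtain ⟨c, w', h, h'⟩ := ih
        refine ⟨d (σ i) * c, σ i :: w', by simp [h], ?_⟩
        simp only [List.map_cons, List.prod_cons, map_mul, h2, h', smul_mul_smul_comm]
    obtain ⟨c, w', hw1, hw2⟩ := hw
    obtain ⟨c', β, hβ1, hβ2⟩ := baseSubst_monomial d σ α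
    rw [map_mul, h1, hw2, hβ2, algebraMap_smul_base, smul_mul_smul_comm]
    exact Submodule.smul_mem _ _ (Submodule.subset_span ⟨β, w', by omega, rfl⟩)
  | zero => simp
  | add a b _ _ ha hb => rw [map_add]; exact add_mem ha hb
  | smul c a _ ha => rw [map_smul]; exact Submodule.smul_mem _ _ ha

variable [CharZero k]

/-- The `k`-algebra endomorphism of `A_g` attached to an element of the monomial group. -/
theorem exists_algHom_alg (d : Fin n → k) (σ : Equiv.Perm (Fin n)) :
    ∃ Φ : Alg k n →ₐ[k] Alg k n,
      (∀ f, Φ (algebraMap (BaseRing k n) _ f) = algebraMap (BaseRing k n) _ (baseSubst d σ f)) ∧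
      ∀ i, Φ (x k n i) = d (σ i) • x k n (σ i) := by
  obtain ⟨Φ, h1, h2⟩ := exists_ringHom (genericForm k n)
    ((algebraMap (BaseRing k n) (Alg k n)).comp (baseSubst d σ).toRingHom)
    (fun f a => Algebra.commutes (baseSubst d σ f) a) (fun i => d (σ i) • x k n (σ i)) (fun i j => by
      simp only [smul_mul_smul_comm]
      rw [mul_comm (d (σ j)), ← smul_add, x_mul_x_add, gram_genericForm]
      rw [← algebraMap_smul_base]
      refine congrArg (algebraMap (BaseRing k n) (Alg k n)) ?_
      change _ = baseSubst d σ _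
      rw [map_mul, baseSubst_X, map_ofNat, mul_smul_comm])
  refine ⟨{ Φ with commutes' := fun c => ?_ }, h1, h2⟩
  change Φ (algebraMap k (Alg k n) c) = _
  rw [IsScalarTower.algebraMap_apply k (BaseRing k n) (Alg k n), h1]
  simp

theorem exists_algHom_B (r : ℕ) (d : Fin n → k) (σ : Equiv.Perm (Fin n)) :
    ∃ H : B k n r →ₐ[k] B k n r,
      (∀ i j, H (tB k n r i j) = (d (σ i) * d (σ j)) • tB k n r (σ i) (σ j)) ∧
      (∀ i, H (zB k n r i) =
        (d (σ i) * (∏ m, d m) ^ ((n + 1) * r)) • zB k n r (σ i)) ∧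
      ∀ m, ∀ b ∈ pieceB k n r m, H b ∈ pieceB k n r m := by
  obtain ⟨Φ, h1, h2⟩ := exists_algHom_alg d σ
  have ht : ∀ i j, Φ (t k n i j) = (d (σ i) * d (σ j)) • t k n (σ i) (σ j) := by
    intro i j
    rw [t, h1, baseSubst_X, algebraMap_smul_base]
    rfl
  have hz : ∀ i, Φ (z k n r i) =
      (d (σ i) * (∏ m, d m) ^ ((n + 1) * r)) • z k n r (σ i) := by
    intro i
    rw [z, map_mul, h1, h2, map_pow, baseSubst_tProd, smul_pow, ← pow_mul,
      algebraMap_smul_base, smul_mul_smul_comm]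
    rfl
  have hB : B k n r ≤ (B k n r).comap Φ := by
    refine Algebra.adjoin_le ?_
    rintro a (⟨i, j, rfl⟩ | ⟨i, rfl⟩)
    · change Φ _ ∈ B k n r
      rw [ht]
      exact Subalgebra.smul_mem _ (tB k n r (σ i) (σ j)).2 _
    · change Φ _ ∈ B k n r
      rw [hz]
      exact Subalgebra.smul_mem _ (zB k n r (σ i)).2 _
  refine ⟨(Φ.comp (B k n r).val).codRestrict (B k n r) fun b => hB b.2, fun i j => ?_,
    fun i => ?_, fun m b hb => ?_⟩
  · exact Subtype.ext (ht i j)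
  · exact Subtype.ext (hz i)
  · exact map_piece_le h1 h2 m hb

variable (k n) in
/-- The action of the monomial group on `B_{g,r}` by endomorphisms. -/
theorem exists_monoidHom (r : ℕ) : ∃ Φ : MonomialGroup k n →* (B k n r ≃ₐ[k] B k n r),
    (∀ g i j, Φ g (tB k n r i j) =
      ((g.left (g.right i) : k) * (g.left (g.right j) : k)) •
        tB k n r (g.right i) (g.right j)) ∧
    (∀ g i, Φ g (zB k n r i) =
      ((g.left (g.right i) : k) * (∏ m, (g.left m : k)) ^ ((n + 1) * r)) •
        zB k n r (g.right i)) ∧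
    ∀ g m, ∀ b ∈ pieceB k n r m, Φ g b ∈ pieceB k n r m := by
  choose H h1 h2 h3 using fun g : MonomialGroup k n =>
    exists_algHom_B r (fun i => (g.left i : k)) g.right
  let H' : MonomialGroup k n →* (B k n r →ₐ[k] B k n r) :=
    { toFun := H
      map_one' := algHom_B_ext (fun i j => by rw [h1]; simp) fun i => by rw [h2]; simp
      map_mul' := fun a b => by
        have hl : ∀ i, ((a * b).left i : k) = a.left i * b.left (a.right.symm i) := fun i => by
          rw [SemidirectProduct.mul_left]
          rfl
        have hp : ∏ m, ((a * b).left m : k) = (∏ m, (a.left m : k)) * ∏ m, (b.left m : k) := by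
          simp only [hl, Finset.prod_mul_distrib]
          congr 1
          exact Equiv.prod_comp a.right.symm fun m => (b.left m : k)
        refine algHom_B_ext (fun i j => ?_) fun i => ?_
        · rw [AlgHom.mul_apply, h1, h1, map_smul, h1, smul_smul, hl, hl]
          simp only [SemidirectProduct.mul_right, Equiv.Perm.mul_apply, Equiv.symm_apply_apply]
          congr 1; ring
        · rw [AlgHom.mul_apply, h2, h2, map_smul, h2, smul_smul, hl, hp]
          simp only [SemidirectProduct.mul_right, Equiv.Perm.mul_apply, Equiv.symm_apply_apply]
          congr 1; ring }
  -- A monoid homomorphism from a group into endomorphisms lands in the units, that is, in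
  -- automorphisms.
  exact ⟨(AlgEquiv.algHomUnitsEquiv k (B k n r)).toMonoidHom.comp H'.toHomUnits, h1, h2, h3⟩

end MonomialAut

/-! ### The grading as a homomorphism to polynomials -/

section Grading

variable {k : Type*} [Field k] {n : ℕ}

/-- `a` is homogeneous of degree `m` with respect to a homomorphism into polynomials. -/
def IsHomogeneousAt {A : Type*} [Ring A] (ρ : A →+* Polynomial A) (m : ℕ) (a : A) : Prop :=
  ρ a = Polynomial.C a * Polynomial.X ^ m

theorem IsHomogeneousAt.mul {A : Type*} [Ring A] {ρ : A →+* Polynomial A} {l m : ℕ} {a b : A}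
    (ha : IsHomogeneousAt ρ l a) (hb : IsHomogeneousAt ρ m b) :
    IsHomogeneousAt ρ (l + m) (a * b) := by
  rw [IsHomogeneousAt, map_mul, ha, hb, map_mul, mul_assoc, mul_assoc, pow_add,
    ← mul_assoc (Polynomial.X ^ l), Polynomial.X_pow_mul (n := l), mul_assoc]

theorem IsHomogeneousAt.pow {A : Type*} [Ring A] {ρ : A →+* Polynomial A} {m : ℕ} {a : A}
    (ha : IsHomogeneousAt ρ m a) (l : ℕ) : IsHomogeneousAt ρ (l * m) (a ^ l) := by
  induction l with
  | zero => simp [IsHomogeneousAt]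
  | succ l ih => rw [pow_succ, Nat.succ_mul]; exact ih.mul ha

/-- In a ring without zero divisors, a square root of a homogeneous element is homogeneous. -/
theorem IsHomogeneousAt.of_mul_self {A : Type*} [Ring A] [NoZeroDivisors A]
    {ρ : A →+* Polynomial A} (hρ : ∀ a, (ρ a).eval 1 = a) {m : ℕ} {a : A} (ha0 : a * a ≠ 0)
    (ha : IsHomogeneousAt ρ (2 * m) (a * a)) : IsHomogeneousAt ρ m a := by
  have h0 : ρ a ≠ 0 := by
    intro h
    have := hρ a
    rw [h, Polynomial.eval_zero] at this
    exact ha0 (by simp [← this])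
  rw [IsHomogeneousAt, map_mul] at ha
  have h1 := congrArg Polynomial.natDegree ha
  rw [Polynomial.natDegree_mul h0 h0, Polynomial.natDegree_C_mul_X_pow _ _ ha0] at h1
  have h2 := congrArg Polynomial.natTrailingDegree ha
  rw [Polynomial.natTrailingDegree_mul h0 h0, Polynomial.C_mul_X_pow_eq_monomial,
    Polynomial.natTrailingDegree_monomial ha0] at h2
  -- Without zero divisors, degree and trailing degree both double on squaring, so both equal m for
  -- ρ a.
  have h3 : ρ a = Polynomial.C ((ρ a).coeff m) * Polynomial.X ^ m := by
    ext l
    rw [Polynomial.coeff_C_mul_X_pow]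
    split_ifs with h
    · rw [h]
    · rcases lt_or_gt_of_ne h with h | h
      · exact Polynomial.coeff_eq_zero_of_lt_natTrailingDegree (by omega)
      · exact Polynomial.coeff_eq_zero_of_natDegree_lt (by omega)
  have h4 : (ρ a).coeff m = a := by
    have := hρ a
    rw [h3] at this
    simpa [← Polynomial.C_mul_X_pow_eq_monomial] using this
  rw [IsHomogeneousAt, h3, h4]

/-- The homomorphism `T_g → A_g[X]` multiplying each variable by `X ^ 2`. -/
noncomputable def baseGrading : BaseRing k n →+* Polynomial (Alg k n) :=
  (Polynomial.mapRingHom (algebraMap (BaseRing k n) (Alg k n))).comp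
    (aeval fun p => Polynomial.C (X p) * Polynomial.X ^ 2 :
      BaseRing k n →ₐ[k] Polynomial (BaseRing k n)).toRingHom

theorem baseGrading_X (p : Sym2 (Fin n)) : (baseGrading (X p) : Polynomial (Alg k n)) =
    Polynomial.C (algebraMap (BaseRing k n) (Alg k n) (X p)) * Polynomial.X ^ 2 := by
  simp [baseGrading]

theorem baseGrading_C (c : k) : (baseGrading (C c) : Polynomial (Alg k n)) =
    Polynomial.C (algebraMap (BaseRing k n) (Alg k n) (C c)) := by
  simp [baseGrading]

theorem map_algebraMap_commute {R A : Type*} [CommRing R] [Ring A] [Algebra R A]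
    (p : Polynomial R) (y : Polynomial A) :
    p.map (algebraMap R A) * y = y * p.map (algebraMap R A) := by
  induction p using Polynomial.induction_on' with
  | add p q hp hq => rw [Polynomial.map_add, add_mul, mul_add, hp, hq]
  | monomial l r =>
    induction y using Polynomial.induction_on' with
    | add p q hp hq => rw [add_mul, mul_add, hp, hq]
    | monomial m a =>
      rw [Polynomial.map_monomial, Polynomial.monomial_mul_monomial,
        Polynomial.monomial_mul_monomial, add_comm, Algebra.commutes]

/-- The grading of `A_g`, encoded as a homomorphism `A_g → A_g[X]`. -/
theorem exists_grading [CharZero k] : ∃ ρ : Alg k n →+* Polynomial (Alg k n),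
    (∀ c : k, IsHomogeneousAt ρ 0 (algebraMap k (Alg k n) c)) ∧
    (∀ p, IsHomogeneousAt ρ 2 (algebraMap (BaseRing k n) (Alg k n) (X p))) ∧
    (∀ i, IsHomogeneousAt ρ 1 (x k n i)) ∧
    (∀ a, (ρ a).eval 1 = a) ∧ ∀ a, (ρ a).eval (-1) = involute a := by
  obtain ⟨ρ, h1, h2⟩ := exists_ringHom (genericForm k n) (baseGrading : _ →+* Polynomial (Alg k n))
    (fun f a => map_algebraMap_commute _ a)
    (fun i => Polynomial.C (x k n i) * Polynomial.X) (fun i j => by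
      have : ∀ a b : Alg k n, Polynomial.C a * Polynomial.X * (Polynomial.C b * Polynomial.X) =
          Polynomial.C (a * b) * Polynomial.X ^ 2 := fun a b => by
        rw [mul_assoc, ← mul_assoc Polynomial.X, Polynomial.X_mul, mul_assoc, ← mul_assoc,
          ← map_mul, sq]
      rw [this, this, ← add_mul, ← map_add, x_mul_x_add, gram_genericForm, map_mul, map_mul,
        map_mul, baseGrading_X, map_ofNat, map_ofNat, map_ofNat, mul_assoc])
  -- One argument serves e = 1 and e = -1: evaluation at a central e with e² = 1 fixes the t's and
  -- multiplies each x_i by e.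
  have hT : ∀ (ψ : Alg k n →+* Alg k n) (e : Alg k n) (he : e * e = 1)
      (hc : ∀ a : Alg k n, Commute a e)
      (hψ : ∀ f, ψ (algebraMap (BaseRing k n) (Alg k n) f) = algebraMap _ _ f)
      (hψx : ∀ i, ψ (x k n i) = x k n i * e) (a : Alg k n), (ρ a).eval e = ψ a := by
    intro ψ e he hc hψ hψx a
    have key : (Polynomial.eval₂RingHom' (RingHom.id (Alg k n)) e hc).comp ρ = ψ := by
      refine ringHom_ext_gen _ (fun f => ?_) fun i => ?_
      · rw [hψ]
        have : ((Polynomial.eval₂RingHom' (RingHom.id (Alg k n)) e hc).comp ρ).comp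
            (algebraMap (BaseRing k n) (Alg k n)) = algebraMap _ _ := by
          refine MvPolynomial.ringHom_ext (fun c => ?_) fun p => ?_
          · simp only [RingHom.comp_apply, h1, baseGrading_C]
            simp [Polynomial.eval₂RingHom']
          · simp only [RingHom.comp_apply, h1, baseGrading_X]
            simp only [Polynomial.eval₂RingHom', RingHom.coe_mk, MonoidHom.coe_mk, OneHom.coe_mk]
            rw [Polynomial.eval₂_mul_noncomm _ _ fun l => hc _]
            simp [sq, he]
        exact RingHom.congr_fun this f
      · rw [← x_eq_gen, hψx, RingHom.comp_apply, x_eq_gen, h2]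
        simp only [Polynomial.eval₂RingHom', RingHom.coe_mk, MonoidHom.coe_mk, OneHom.coe_mk]
        rw [Polynomial.eval₂_mul_noncomm _ _ fun l => hc _]
        simp [x_eq_gen]
    rw [← key]
    rfl
  refine ⟨ρ, fun c => ?_, fun p => ?_, fun i => ?_, ?_, ?_⟩
  · rw [IsHomogeneousAt, IsScalarTower.algebraMap_apply k (BaseRing k n) (Alg k n), h1,
      MvPolynomial.algebraMap_eq, baseGrading_C, pow_zero, mul_one]
  · rw [IsHomogeneousAt, h1, baseGrading_X]
  · rw [IsHomogeneousAt, pow_one]; exact h2 i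
  · exact hT (RingHom.id _) 1 (mul_one 1) (fun a => Commute.one_right a) (fun f => rfl)
      fun i => (mul_one _).symm
  · exact hT (involute : Alg k n →ₐ[BaseRing k n] Alg k n).toRingHom (-1) (by simp)
      (fun a => (Commute.one_right a).neg_right) (fun f => AlgHom.commutes _ f)
      fun i => (involute_gen _ i).trans (by rw [mul_neg, mul_one]; rfl)

theorem mem_span_monomial_mul_word (a : Alg k n) :
    a ∈ Submodule.span k {a | ∃ (α : Sym2 (Fin n) →₀ ℕ) (w : List (Fin n)),
      a = algebraMap (BaseRing k n) (Alg k n) (monomial α 1) * (w.map (x k n)).prod} := by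
  induction a using wordSpan_induction with
  | word w =>
    refine Submodule.subset_span ⟨0, w, ?_⟩
    rw [show (monomial 0 1 : BaseRing k n) = 1 from rfl, map_one, one_mul]
    rfl
  | add a b ha hb => exact add_mem ha hb
  | smul f a ha =>
    induction f using MvPolynomial.induction_on' with
    | add f g hf hg => rw [add_smul]; exact add_mem hf hg
    | monomial α c =>
      have e : (monomial α c : BaseRing k n) = c • monomial α 1 := by
        rw [smul_monomial, smul_eq_mul, mul_one]
      rw [e, smul_assoc]
      refine Submodule.smul_mem _ _ ?_
      induction ha using Submodule.span_induction with
      | mem a h =>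
        obtain ⟨β, w, rfl⟩ := h
        rw [Algebra.smul_def (monomial α 1 : BaseRing k n), ← mul_assoc, ← map_mul, monomial_mul,
          one_mul]
        exact Submodule.subset_span ⟨_, w, rfl⟩
      | zero => simp
      | add a b _ _ ha hb => rw [smul_add]; exact add_mem ha hb
      | smul r a _ ha => rw [smul_comm]; exact Submodule.smul_mem _ _ ha

theorem mem_span_x_of_isHomogeneousAt {ρ : Alg k n →+* Polynomial (Alg k n)}
    (h0 : ∀ c : k, IsHomogeneousAt ρ 0 (algebraMap k (Alg k n) c))
    (ht : ∀ p, IsHomogeneousAt ρ 2 (algebraMap (BaseRing k n) (Alg k n) (X p)))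
    (hx : ∀ i, IsHomogeneousAt ρ 1 (x k n i)) {a : Alg k n} (ha : IsHomogeneousAt ρ 1 a) :
    a ∈ Submodule.span k (Set.range (x k n)) := by
  have hmon : ∀ α : Sym2 (Fin n) →₀ ℕ, IsHomogeneousAt ρ (2 * α.degree)
      (algebraMap (BaseRing k n) (Alg k n) (monomial α 1)) := by
    intro α
    induction α using Finsupp.induction_linear with
    | zero => simpa using h0 1
    | add α β hα hβ =>
      have := hα.mul hβ
      rwa [← map_mul, monomial_mul, one_mul, ← mul_add, ← map_add] at this
    | single p e =>
      rw [← MvPolynomial.X_pow_eq_monomial, map_pow, Finsupp.degree_single, mul_comm]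
      exact (ht p).pow e
  have hword : ∀ w : List (Fin n), IsHomogeneousAt ρ w.length (w.map (x k n)).prod := by
    intro w
    induction w with
    | nil => simpa using h0 1
    | cons i w ih =>
      rw [List.map_cons, List.prod_cons, List.length_cons, add_comm]
      exact (hx i).mul ih
  -- A monomial times a word has degree 1 only if the monomial is trivial and the word is one
  -- letter.
  have key : ∀ a : Alg k n, (ρ a).coeff 1 ∈ Submodule.span k (Set.range (x k n)) := by
    intro a
    induction mem_span_monomial_mul_word a using Submodule.span_induction with
    | mem a h =>
      obtain ⟨α, w, rfl⟩ := h
      rw [(hmon α).mul (hword w), Polynomial.coeff_C_mul_X_pow]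
      split_ifs with h
      · obtain rfl : α = 0 := (Finsupp.degree_eq_zero_iff α).1 (by omega)
        obtain ⟨i, rfl⟩ := List.length_eq_one_iff.1 (show w.length = 1 by simpa using h.symm)
        refine Submodule.subset_span ⟨i, ?_⟩
        rw [show (monomial 0 1 : BaseRing k n) = 1 from rfl]
        simp
      · exact zero_mem _
    | zero => simp
    | add a b _ _ ha hb => rw [map_add, Polynomial.coeff_add]; exact add_mem ha hb
    | smul c a _ ha =>
      have := h0 c
      rw [IsHomogeneousAt, pow_zero, mul_one] at this
      rw [Algebra.smul_def, map_mul, this, Polynomial.coeff_C_mul, ← Algebra.smul_def]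
      exact Submodule.smul_mem _ _ ha
  have h := key a
  rwa [ha, pow_one, Polynomial.coeff_C_mul_X, if_pos rfl] at h

end Grading

/-! ### Restriction of automorphisms to the base ring -/

section Base

variable {k : Type*} [Field k] {n r : ℕ}

variable (k n r) in
/-- The inclusion of the base ring in `B_{g,r}`. -/
noncomputable def baseIncl : BaseRing k n →ₐ[k] B k n r :=
  (IsScalarTower.toAlgHom k (BaseRing k n) (Alg k n)).codRestrict (B k n r) (algebraMap_mem_B r)

theorem coe_baseIncl (f : BaseRing k n) :
    (baseIncl k n r f : Alg k n) = algebraMap (BaseRing k n) (Alg k n) f := rfl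

theorem baseIncl_X (i j : Fin n) : baseIncl k n r (X s(i, j)) = tB k n r i j := rfl

theorem baseIncl_commute (f : BaseRing k n) (b : B k n r) :
    b * baseIncl k n r f = baseIncl k n r f * b :=
  Subtype.ext (Algebra.commutes f (b : Alg k n)).symm

theorem z_eq_smul (i : Fin n) : z k n r i = tProd k n ^ r • x k n i := by
  rw [z, Algebra.smul_def, Algebra.commutes]

theorem tProd_ne_zero : tProd k n ≠ 0 :=
  Finset.prod_ne_zero_iff.2 fun p _ => X_ne_zero p

/-- T + P^r A is closed under products because T and P are central, and it contains the generators.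
-/
theorem exists_eq_add_smul {b : Alg k n} (hb : b ∈ B k n r) :
    ∃ (f : BaseRing k n) (u : Alg k n), b = algebraMap _ _ f + tProd k n ^ r • u := by
  induction hb using Algebra.adjoin_induction with
  | mem a h =>
    rcases h with ⟨i, j, rfl⟩ | ⟨i, rfl⟩
    · exact ⟨X s(i, j), 0, by rw [smul_zero, add_zero]; rfl⟩
    · exact ⟨0, x k n i, by rw [z_eq_smul, map_zero, zero_add]⟩
  | algebraMap c =>
    exact ⟨C c, 0, by
      rw [smul_zero, add_zero, ← MvPolynomial.algebraMap_eq, ← IsScalarTower.algebraMap_apply]⟩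
  | add a b _ _ ha hb =>
    obtain ⟨f, u, rfl⟩ := ha
    obtain ⟨f', u', rfl⟩ := hb
    exact ⟨f + f', u + u', by rw [map_add, smul_add]; abel⟩
  | mul a b _ _ ha hb =>
    obtain ⟨f, u, rfl⟩ := ha
    obtain ⟨f', u', rfl⟩ := hb
    refine ⟨f * f', f • u' + f' • u + tProd k n ^ r • (u * u'), ?_⟩
    simp only [Algebra.smul_def, map_mul, mul_add, add_mul]
    set P := algebraMap (BaseRing k n) (Alg k n) (tProd k n ^ r) with hP
    set F := algebraMap (BaseRing k n) (Alg k n) f with hF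
    set F' := algebraMap (BaseRing k n) (Alg k n) f' with hF'
    have c1 : ∀ a, P * a = a * P := fun a => Algebra.commutes _ a
    have c2 : ∀ a, F' * a = a * F' := fun a => Algebra.commutes _ a
    rw [← mul_assoc F P, ← c1 F, mul_assoc P u F', ← c2 u, mul_assoc P u (P * u'), ← mul_assoc u P,
      ← c1 u]
    simp only [mul_assoc]
    abel

theorem x_mul_self [CharZero k] (i : Fin n) :
    x k n i * x k n i = algebraMap (BaseRing k n) (Alg k n) (X s(i, i)) := by
  have h := x_mul_x_add k n i i
  rw [← two_smul (BaseRing k n), map_mul, ← Algebra.smul_def] at h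
  exact CliffordAlgebra.smul_left_cancel _ (two_ne_zero (α := BaseRing k n)) h

/-- With w = x_i x_j and τ = 2 t_(i,j), the commutator is 2w - τ and w^2 = τ w - t_(i,i) t_(j,j). -/
theorem commutator_mul_self [CharZero k] (i j : Fin n) :
    (x k n i * x k n j - x k n j * x k n i) * (x k n i * x k n j - x k n j * x k n i) =
      algebraMap (BaseRing k n) (Alg k n)
        (4 * (X s(i, j) ^ 2 - X s(i, i) * X s(j, j))) := by
  set a := x k n i
  set b := x k n j
  have h1 : b * a = algebraMap (BaseRing k n) _ (2 * X s(i, j)) - a * b := by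
    rw [← x_mul_x_add]; abel
  have ha : a * a = algebraMap (BaseRing k n) _ (X s(i, i)) := x_mul_self i
  have hb : b * b = algebraMap (BaseRing k n) _ (X s(j, j)) := x_mul_self j
  have h2 : a * b * (a * b) = algebraMap (BaseRing k n) _ (2 * X s(i, j)) * (a * b) -
      algebraMap (BaseRing k n) _ (X s(i, i) * X s(j, j)) := by
    rw [mul_assoc, ← mul_assoc b, h1, sub_mul, mul_sub, Algebra.left_comm, mul_assoc a b b, hb,
      ← mul_assoc a a, ha, map_mul _ (X s(i, i))]
  have h3 : algebraMap (BaseRing k n) (Alg k n) (2 * X s(i, j)) * (a * b) =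
    a * b * algebraMap _ _ (2 * X s(i, j)) := Algebra.commutes _ _
  have h4 : ∀ w τ : Alg k n, (w - (τ - w)) * (w - (τ - w)) =
      4 * (w * w) - 4 * (τ * w) + τ * τ + 2 * (τ * w - w * τ) := fun w τ => by noncomm_ring
  rw [h1, h4, h2, h3, sub_self, mul_zero, add_zero, mul_sub, sub_sub_cancel_left,
    ← map_ofNat (algebraMap (BaseRing k n) (Alg k n)) 4]
  simp only [← map_mul, ← map_neg, ← map_add]
  congr 1
  ring

variable [CharZero k]

/-- The scalar parts drop out of the commutator, leaving a multiple of P^(2r). The T-linear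
retraction `scalarPart` carries divisibility of the square back to T. -/
theorem tProd_pow_dvd_of_commutator {b c : Alg k n} (hb : b ∈ B k n r) (hc : c ∈ B k n r)
    {f : BaseRing k n} (h : (b * c - c * b) * (b * c - c * b) = algebraMap _ _ f) :
    tProd k n ^ (4 * r) ∣ f := by
  obtain ⟨p, u, rfl⟩ := exists_eq_add_smul hb
  obtain ⟨q, v, rfl⟩ := exists_eq_add_smul hc
  have e : (algebraMap _ _ p + tProd k n ^ r • u) * (algebraMap _ _ q + tProd k n ^ r • v) -
      (algebraMap _ _ q + tProd k n ^ r • v) * (algebraMap _ _ p + tProd k n ^ r • u) =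
      tProd k n ^ (2 * r) • (u * v - v * u) := by
    simp only [mul_add, add_mul, mul_smul_comm, smul_mul_assoc,
      Algebra.commutes p, Algebra.commutes q u, two_mul, pow_add, smul_sub, ← map_mul, smul_add,
      smul_smul]
    abel
  rw [e, smul_mul_smul_comm, ← pow_add, ← add_mul] at h
  have h' := congrArg (scalarPart (genericForm k n)) h
  rw [map_smul, scalarPart_algebraMap] at h'
  exact ⟨_, h'.symm⟩

theorem exists_baseIncl_of_commute (hn : Even n) {b : B k n r} (hb : ∀ c, c * b = b * c) :
    ∃ f, baseIncl k n r f = b := by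
  obtain ⟨f, hf⟩ := mem_range_of_commute_gen (genericForm k n) hn (det_gram_genericForm k n)
    (b := (b : Alg k n)) fun i => by
      have h := congrArg (Subtype.val) (hb (zB k n r i))
      change z k n r i * (b : Alg k n) = b * z k n r i at h
      rw [z_eq_smul, smul_mul_assoc, mul_smul_comm] at h
      exact CliffordAlgebra.smul_left_cancel _ (pow_ne_zero _ tProd_ne_zero) h
  exact ⟨f, Subtype.ext hf⟩

theorem baseIncl_injective : Function.Injective (baseIncl k n r) := fun _ _ h =>
  CliffordAlgebra.algebraMap_injective (genericForm k n) (congrArg Subtype.val h)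

theorem exists_algHom_base (hn : Even n) (g : B k n r ≃ₐ[k] B k n r) :
    ∃ γ : BaseRing k n →ₐ[k] BaseRing k n, ∀ f, g (baseIncl k n r f) = baseIncl k n r (γ f) := by
  have h : ∀ f, ∃ f', baseIncl k n r f' = g (baseIncl k n r f) := fun f =>
    exists_baseIncl_of_commute hn fun c => by
      obtain ⟨c, rfl⟩ := g.surjective c
      rw [← map_mul, baseIncl_commute, map_mul]
  choose γ hγ using h
  refine ⟨{ toFun := γ
            map_one' := baseIncl_injective (r := r) (by rw [hγ]; simp)
            map_zero' := baseIncl_injective (r := r) (by rw [hγ]; simp)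
            map_mul' := fun a b => baseIncl_injective (r := r) (by simp only [hγ, map_mul])
            map_add' := fun a b => baseIncl_injective (r := r) (by simp only [hγ, map_add])
            commutes' := fun c => baseIncl_injective (r := r) (by
              rw [hγ, AlgHom.commutes, AlgEquiv.commutes]) }, fun f => (hγ f).symm⟩

/-- An automorphism of `B_{g,r}` restricts to the base ring. -/
theorem exists_algEquiv_base (hn : Even n) (g : B k n r ≃ₐ[k] B k n r) :
    ∃ γ : BaseRing k n ≃ₐ[k] BaseRing k n, (∀ f, g (baseIncl k n r f) = baseIncl k n r (γ f)) ∧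
      ∀ f, g.symm (baseIncl k n r f) = baseIncl k n r (γ.symm f) := by
  obtain ⟨γ, hγ⟩ := exists_algHom_base hn g
  obtain ⟨δ, hδ⟩ := exists_algHom_base hn g.symm
  exact ⟨AlgEquiv.ofAlgHom γ δ
    (AlgHom.ext fun f => baseIncl_injective (r := r) (by
      change baseIncl k n r (γ (δ f)) = _; rw [← hγ, ← hδ]; simp))
    (AlgHom.ext fun f => baseIncl_injective (r := r) (by
      change baseIncl k n r (δ (γ f)) = _; rw [← hδ, ← hγ]; simp)), hγ, hδ⟩

theorem exists_map_X (hn : Even n) (hr : 0 < r) {g : B k n r ≃ₐ[k] B k n r}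
    {γ : BaseRing k n ≃ₐ[k] BaseRing k n}
    (hγ : ∀ f, g.symm (baseIncl k n r f) = baseIncl k n r (γ.symm f)) (p : Sym2 (Fin n)) :
    ∃ (c : k) (q : Sym2 (Fin n)), c ≠ 0 ∧ γ (X p) = c • X q := by
  obtain ⟨i, j, hij⟩ : ∃ i j : Fin n, i ≠ j := by
    have : 0 < n := by
      induction p using Sym2.ind with
      | _ i j => exact i.pos
    obtain ⟨m, rfl⟩ := hn
    exact ⟨⟨0, by omega⟩, ⟨1, by omega⟩, by simp⟩
  set G : BaseRing k n := 4 * (X s(i, j) ^ 2 - X s(i, i) * X s(j, j)) with hG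
  have hG0 : G ≠ 0 := by
    classical
    intro h
    have h1 := congrArg (MvPolynomial.eval fun q : Sym2 (Fin n) => if q = s(i, j) then (1 : k)
      else 0) h
    have hi : s(i, i) ≠ s(i, j) := by simp [hij]
    simp [G, hi] at h1
  have hGdeg : G.totalDegree ≤ 2 := by
    have h4 : (4 : BaseRing k n) = C 4 := (map_ofNat C 4).symm
    rw [hG, h4]
    refine (totalDegree_mul _ _).trans ?_
    rw [totalDegree_C, zero_add]
    refine (totalDegree_sub _ _).trans (max_le ?_ ?_)
    · exact (totalDegree_pow _ _).trans (by rw [totalDegree_X])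
    · exact (totalDegree_mul _ _).trans (by rw [totalDegree_X, totalDegree_X])
  have hsq : (z k n r i * z k n r j - z k n r j * z k n r i) *
      (z k n r i * z k n r j - z k n r j * z k n r i) =
      algebraMap (BaseRing k n) (Alg k n) (tProd k n ^ (4 * r) * G) := by
    rw [map_mul, hG, ← commutator_mul_self, ← Algebra.smul_def]
    simp only [z_eq_smul, smul_mul_smul_comm]
    rw [← smul_sub, smul_mul_smul_comm, ← pow_add, ← pow_add]
    congr 2; ring
  have hdvd : tProd k n ^ (4 * r) ∣ γ.symm (tProd k n ^ (4 * r) * G) := by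
    refine tProd_pow_dvd_of_commutator (g.symm (zB k n r i)).2 (g.symm (zB k n r j)).2 ?_
    rw [← coe_baseIncl (r := r), ← hγ]
    have h1 : (zB k n r i * zB k n r j - zB k n r j * zB k n r i) *
      (zB k n r i * zB k n r j - zB k n r j * zB k n r i) =
        baseIncl k n r (tProd k n ^ (4 * r) * G) := Subtype.ext hsq
    rw [← h1, map_mul, map_sub, map_mul, map_mul]
    rfl
  have hπ : Prime (γ (X p)) := (MulEquiv.prime_iff γ.toMulEquiv).2 (X_prime (R := k) (i := p))
  have hdvd' : γ (X p) ^ (4 * r) ∣ tProd k n ^ (4 * r) * G := by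
    have h1 : γ (tProd k n ^ (4 * r)) ∣ tProd k n ^ (4 * r) * G := by
      simpa using map_dvd γ hdvd
    refine dvd_trans ?_ h1
    rw [map_pow]
    exact pow_dvd_pow_of_dvd (map_dvd γ (Finset.dvd_prod_of_mem _ (Finset.mem_univ p))) _
  have hP : γ (X p) ∣ tProd k n := by
    by_contra hP
    have h1 : γ (X p) ^ (4 * r) ∣ G :=
      hπ.pow_dvd_of_dvd_mul_left _ (fun h => hP (hπ.dvd_of_dvd_pow h)) hdvd'
    -- The cube of γ(t_p) divides G, whose degree is at most 2, so γ(t_p) would be constant, hence a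
    -- unit.
    have h2 := totalDegree_le_of_dvd_of_isDomain
      ((pow_dvd_pow _ (show 3 ≤ 4 * r by omega)).trans h1) hG0
    rw [pow_succ, sq, totalDegree_mul_of_isDomain (mul_ne_zero hπ.ne_zero hπ.ne_zero) hπ.ne_zero,
      totalDegree_mul_of_isDomain hπ.ne_zero hπ.ne_zero] at h2
    have h3 := totalDegree_eq_zero_iff_eq_C.1 (show (γ (X p)).totalDegree = 0 by omega)
    refine hπ.not_isUnit ?_
    rw [h3]
    refine (IsUnit.mk0 _ fun h => hπ.ne_zero ?_).map C
    rw [h3, h, map_zero]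
  obtain ⟨q, -, hq⟩ := (hπ.dvd_finsetProd_iff _).1 hP
  obtain ⟨u, hu⟩ := (hπ.irreducible.associated_of_dvd (X_prime (R := k) (i := q)).irreducible hq).symm
  obtain ⟨c, hc, hc'⟩ := isUnit_iff_eq_C_of_isReduced.1 u.isUnit
  exact ⟨c, q, hc.ne_zero, by rw [← hu, hc', mul_comm, smul_eq_C_mul]⟩

end Base

/-! ### Every automorphism is monomial -/

section Classification

variable {k : Type*} [Field k] {n r : ℕ}

theorem smul_X_inj {c c' : k} (hc : c ≠ 0) {p q : Sym2 (Fin n)}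
    (h : (c • X p : BaseRing k n) = c' • X q) : p = q := by
  classical
  by_contra hpq
  have := congrArg (MvPolynomial.eval fun q : Sym2 (Fin n) => if q = p then (1 : k) else 0) h
  simp [Ne.symm hpq] at this
  exact hc this

/-- An automorphism of the base ring permuting the variables up to scalars scales their
product. -/
theorem exists_map_tProd {γ : BaseRing k n ≃ₐ[k] BaseRing k n}
    (hγ : ∀ p, ∃ (c : k) (q : Sym2 (Fin n)), c ≠ 0 ∧ γ (X p) = c • X q) :
    ∃ c : k, c ≠ 0 ∧ γ (tProd k n) = c • tProd k n := by
  choose c τ hc h using hγ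
  have hτ : Function.Bijective τ := by
    refine Finite.injective_iff_bijective.1 fun p q hpq => ?_
    refine smul_X_inj (hc q) (c' := c p) (γ.injective ?_)
    rw [map_smul, map_smul, h, h, hpq, smul_smul, smul_smul, mul_comm]
  refine ⟨∏ p, c p, Finset.prod_ne_zero_iff.2 fun p _ => hc p, ?_⟩
  simp only [tProd, map_prod, h]
  rw [Finset.prod_smul]
  congr 1
  exact Fintype.prod_bijective τ hτ _ _ fun p => rfl

theorem zB_mul_add (i j : Fin n) : zB k n r i * zB k n r j + zB k n r j * zB k n r i =
    baseIncl k n r (tProd k n ^ (2 * r) * (2 * X s(i, j))) := by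
  refine Subtype.ext ?_
  change z k n r i * z k n r j + z k n r j * z k n r i = algebraMap _ _ _
  rw [z_eq_smul, z_eq_smul, smul_mul_smul_comm, smul_mul_smul_comm, ← smul_add, x_mul_x_add,
    ← pow_add, ← two_mul, Algebra.smul_def, ← map_mul]

/-- Comparison of the coefficients in `∑ a_l a_m t_(l,m) = c t_q`. -/
theorem exists_single_of_sum_eq {a : Fin n → k} {c : k} (hc : c ≠ 0) {q : Sym2 (Fin n)}
    (h : (∑ l, ∑ m, (a l * a m) • X s(l, m) : BaseRing k n) = c • X q) :
    ∃ l, a l ≠ 0 ∧ ∀ m, m ≠ l → a m = 0 := by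
  classical
  -- Setting t_(l,l) = 1 and all other variables to 0 isolates the diagonal coefficient.
  have hl : ∀ l, a l ^ 2 = if q = s(l, l) then c else 0 := by
    intro l
    have h1 := congrArg (MvPolynomial.eval fun p : Sym2 (Fin n) => if p = s(l, l) then (1 : k)
      else 0) h
    simp only [map_sum, smul_eval, eval_X, mul_ite, mul_one, mul_zero] at h1
    rw [← h1, Finset.sum_eq_single l, Finset.sum_eq_single l]
    · simp [sq]
    · intro m _ hm; simp [hm]
    · simp
    · intro m _ hm
      exact Finset.sum_eq_zero fun m' _ => by simp [hm]
    · simp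
  by_cases hq : ∃ l, q = s(l, l)
  · obtain ⟨l, rfl⟩ := hq
    refine ⟨l, fun h => ?_, fun m hm => ?_⟩
    · have := hl l
      simp [h] at this
      exact hc this.symm
    · have := hl m
      simpa [Ne.symm hm] using this
  · exfalso
    push Not at hq
    have ha : ∀ l, a l = 0 := fun l => by simpa [hq l] using hl l
    simp [ha] at h
    exact smul_ne_zero hc (X_ne_zero q) h.symm

variable [CharZero k]

/-- Writing b = f + P^r u, one has 2b = b - involute b = P^r (u - involute u), as the scalar f is
even. -/
theorem exists_eq_smul_of_involute {b : Alg k n} (hb : b ∈ B k n r) (h : involute b = -b) :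
    ∃ η : Alg k n, b = tProd k n ^ r • η := by
  obtain ⟨f, u, rfl⟩ := exists_eq_add_smul hb
  refine ⟨(2⁻¹ : k) • (u - involute u), ?_⟩
  rw [map_add, AlgHom.commutes, map_smul] at h
  have h1 : (2 : k) • (algebraMap (BaseRing k n) (Alg k n) f + tProd k n ^ r • u) =
      tProd k n ^ r • (u - involute u) := by
    rw [two_smul, smul_sub]
    nth_rw 1 [← neg_neg (algebraMap (BaseRing k n) (Alg k n) f + tProd k n ^ r • u), ← h]
    abel
  rw [smul_comm, ← h1, smul_smul, inv_mul_cancel₀ two_ne_zero, one_smul]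

theorem exists_map_zB (hn : Even n) {g : B k n r ≃ₐ[k] B k n r}
    {γ : BaseRing k n ≃ₐ[k] BaseRing k n}
    (hg : ∀ f, g (baseIncl k n r f) = baseIncl k n r (γ f))
    (hγ : ∀ p, ∃ (c : k) (q : Sym2 (Fin n)), c ≠ 0 ∧ γ (X p) = c • X q) (i : Fin n) :
    ∃ a : Fin n → k, g (zB k n r i) = ∑ j, a j • zB k n r j := by
  have := noZeroDivisors_alg k n hn
  obtain ⟨ρ, h0, ht, hx, hρ1, hρ2⟩ := exists_grading (k := k) (n := n)
  obtain ⟨e, he, hP⟩ := exists_map_tProd hγ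
  obtain ⟨c, q, hc, hq⟩ := hγ s(i, i)
  set y : Alg k n := (g (zB k n r i) : Alg k n) with hy
  set N := Fintype.card (Sym2 (Fin n)) with hN
  have hPh : IsHomogeneousAt ρ (N * 2) (algebraMap (BaseRing k n) (Alg k n) (tProd k n)) := by
    have : ∀ s : Finset (Sym2 (Fin n)), IsHomogeneousAt ρ (s.card * 2)
        (algebraMap (BaseRing k n) (Alg k n) (∏ p ∈ s, X p)) := by
      classical
      intro s
      induction s using Finset.induction_on with
      | empty => simpa using h0 1
      | insert p s hp ih =>
        rw [Finset.prod_insert hp, map_mul, Finset.card_insert_of_notMem hp, add_mul, one_mul,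
          add_comm]
        exact (ht p).mul ih
    exact this Finset.univ
  have hyy : y * y = algebraMap k (Alg k n) (c * e ^ (2 * r)) *
      (algebraMap (BaseRing k n) (Alg k n) (X q) *
        algebraMap (BaseRing k n) (Alg k n) (tProd k n) ^ (2 * r)) := by
    have h1 : zB k n r i * zB k n r i = baseIncl k n r (tProd k n ^ (2 * r) * X s(i, i)) := by
      refine Subtype.ext ?_
      change z k n r i * z k n r i = algebraMap _ _ _
      rw [z_eq_smul, smul_mul_smul_comm, x_mul_self, ← pow_add, ← two_mul, Algebra.smul_def,
        map_mul]
    have h2 : y * y = algebraMap (BaseRing k n) (Alg k n)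
        (γ (tProd k n ^ (2 * r) * X s(i, i))) := by
      rw [← coe_baseIncl (r := r), ← hg, ← h1, map_mul]
      rfl
    rw [h2, map_mul γ, map_pow, hP, hq, IsScalarTower.algebraMap_apply k (BaseRing k n) (Alg k n),
      ← map_pow, ← map_mul, ← map_mul, MvPolynomial.algebraMap_eq]
    congr 1
    simp only [smul_eq_C_mul, map_mul, map_pow]
    ring
  have hinj := CliffordAlgebra.algebraMap_injective (genericForm k n)
  have hP0 : algebraMap (BaseRing k n) (Alg k n) (tProd k n) ≠ 0 :=
    (map_ne_zero_iff _ hinj).2 tProd_ne_zero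
  have hyy0 : y * y ≠ 0 := by
    rw [hyy, IsScalarTower.algebraMap_apply k (BaseRing k n) (Alg k n)]
    refine mul_ne_zero ((map_ne_zero_iff _ hinj).2 ?_)
      (mul_ne_zero ((map_ne_zero_iff _ hinj).2 (X_ne_zero _)) (pow_ne_zero _ hP0))
    exact C_ne_zero.2 (mul_ne_zero hc (pow_ne_zero _ he))
  have hyh : IsHomogeneousAt ρ (1 + N * (2 * r)) y := by
    refine IsHomogeneousAt.of_mul_self hρ1 hyy0 ?_
    rw [hyy]
    have := (h0 (c * e ^ (2 * r))).mul ((ht q).mul (hPh.pow (2 * r)))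
    convert this using 1
    ring
  -- The degree 1 + 2rN of y is odd, and evaluating ρ at -1 gives the involution.
  have hodd : involute y = -y := by
    rw [← hρ2, hyh, Polynomial.eval_mul_X_pow, Polynomial.eval_C, pow_add, mul_left_comm N 2 r,
      pow_mul _ 2]
    simp
  obtain ⟨η, hη⟩ := exists_eq_smul_of_involute (r := r) (g (zB k n r i)).2 hodd
  rw [← hy, Algebra.smul_def, map_pow] at hη
  have hηh : IsHomogeneousAt ρ 1 η := by
    have hPr := hPh.pow r
    rw [hη, IsHomogeneousAt, map_mul, hPr] at hyh
    have hX : (Polynomial.C (algebraMap (BaseRing k n) (Alg k n) (tProd k n) ^ r) *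
      Polynomial.X ^ (r * (N * 2))) ≠ 0 := by
      rw [Polynomial.C_mul_X_pow_eq_monomial]
      exact fun h => pow_ne_zero r hP0 ((Polynomial.monomial_eq_zero_iff _ _).1 h)
    refine mul_left_cancel₀ hX ?_
    rw [hyh, map_mul, mul_assoc, mul_assoc, ← mul_assoc (Polynomial.X ^ _),
      Polynomial.X_pow_mul, mul_assoc, ← pow_add]
    congr 3
    ring
  obtain ⟨a, ha⟩ := (Submodule.mem_span_range_iff_exists_fun k).1
    (mem_span_x_of_isHomogeneousAt h0 ht hx hηh)
  refine ⟨a, Subtype.ext ?_⟩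
  rw [← hy, hη, ← ha, Finset.mul_sum]
  rw [AddSubmonoidClass.coe_finsetSum]
  refine Finset.sum_congr rfl fun j _ => ?_
  rw [mul_smul_comm, ← map_pow, ← Algebra.smul_def]
  change _ = a j • z k n r j
  rw [z_eq_smul]

/-- Automorphisms of `B_{g,r}` are monomial. -/
theorem exists_monomial (hn : Even n) (hr : 0 < r) (g : B k n r ≃ₐ[k] B k n r) :
    ∃ (d : Fin n → kˣ) (σ : Equiv.Perm (Fin n)),
      (∀ i j, g (tB k n r i j) = ((d (σ i) : k) * (d (σ j) : k)) • tB k n r (σ i) (σ j)) ∧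
      ∀ i, g (zB k n r i) =
        ((d (σ i) : k) * (∏ m, (d m : k)) ^ ((n + 1) * r)) • zB k n r (σ i) := by
  obtain ⟨γ, hg, hg'⟩ := exists_algEquiv_base hn g
  have hγ := exists_map_X hn hr hg'
  obtain ⟨e, he, hP⟩ := exists_map_tProd hγ
  choose a ha using exists_map_zB hn hg hγ
  -- Apply g to the anticommutator of z_i and z_j, then cancel 2 P^(2r).
  have hrel : ∀ i j, ∑ l, ∑ m, (a i l * a j m) • (X s(l, m) : BaseRing k n) =
      e ^ (2 * r) • γ (X s(i, j)) := by
    intro i j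
    have h1 := congrArg g (zB_mul_add (r := r) i j)
    rw [hg, map_add, map_mul, map_mul, ha, ha, Finset.sum_mul_sum, Finset.sum_mul_sum,
      Finset.sum_comm (f := fun l m => a j l • zB k n r l * a i m • zB k n r m)] at h1
    simp only [← Finset.sum_add_distrib, smul_mul_smul_comm] at h1
    have h2 : baseIncl k n r (tProd k n ^ (2 * r) * (2 *
        ∑ l, ∑ m, (a i l * a j m) • (X s(l, m) : BaseRing k n))) =
        baseIncl k n r (tProd k n ^ (2 * r) * (2 * (e ^ (2 * r) • γ (X s(i, j))))) := by
      have e1 : tProd k n ^ (2 * r) * (2 * (e ^ (2 * r) • γ (X s(i, j)))) =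
          γ (tProd k n ^ (2 * r) * (2 * X s(i, j))) := by
        simp only [map_mul, map_pow, hP, map_ofNat, smul_pow, smul_mul_assoc, mul_smul_comm]
      rw [e1, ← h1, Finset.mul_sum, Finset.mul_sum, map_sum]
      refine Finset.sum_congr rfl fun l _ => ?_
      rw [Finset.mul_sum, Finset.mul_sum, map_sum]
      refine Finset.sum_congr rfl fun m _ => ?_
      rw [mul_comm (a j m), ← smul_add, zB_mul_add, mul_smul_comm, mul_smul_comm, map_smul]
    exact mul_left_cancel₀ two_ne_zero
      (mul_left_cancel₀ (pow_ne_zero _ tProd_ne_zero) (baseIncl_injective h2))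
  have hsingle : ∀ i, ∃ l, a i l ≠ 0 ∧ ∀ m, m ≠ l → a i m = 0 := by
    intro i
    obtain ⟨c, q, hc, hq⟩ := hγ s(i, i)
    refine exists_single_of_sum_eq (c := e ^ (2 * r) * c) (q := q)
      (mul_ne_zero (pow_ne_zero _ he) hc) ?_
    rw [hrel, hq, smul_smul]
  choose s hs hs' using hsingle
  -- Of the coefficient of z_(s i), the factor e^r is due to P^r; the quotient is the scalar by
  -- which x_i would move.
  have hrel' : ∀ i j, γ (X s(i, j)) =
      ((a i (s i) / e ^ r) * (a j (s j) / e ^ r)) • (X s(s i, s j) : BaseRing k n) := by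
    intro i j
    have h1 := hrel i j
    rw [Finset.sum_eq_single (s i) (fun l _ hl => by simp [hs' i l hl]) (by simp),
      Finset.sum_eq_single (s j) (fun l _ hl => by simp [hs' j l hl]) (by simp)] at h1
    have h2 : γ (X s(i, j)) = (e ^ (2 * r))⁻¹ • e ^ (2 * r) • γ (X s(i, j)) := by
      rw [smul_smul, inv_mul_cancel₀ (pow_ne_zero _ he), one_smul]
    rw [h2, ← h1, smul_smul]
    congr 1
    field_simp
    ring
  have hsinj : Function.Injective s := by
    intro i j hij
    have h1 : (s(i, i) : Sym2 (Fin n)) = s(j, j) := by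
      refine smul_X_inj (c := a j (s j) * a j (s j)) (c' := a i (s i) * a i (s i))
        (mul_ne_zero (hs j) (hs j)) (γ.injective ?_)
      rw [map_smul, map_smul, hrel', hrel', ← hij, smul_smul, smul_smul]
      congr 1
      ring
    simpa using h1
  let σ : Equiv.Perm (Fin n) := Equiv.ofBijective s (Finite.injective_iff_bijective.1 hsinj)
  let d : Fin n → kˣ := fun l =>
    Units.mk0 (a (σ.symm l) (s (σ.symm l)) / e ^ r) (div_ne_zero (hs _) (pow_ne_zero _ he))
  have hd : ∀ i, (d (σ i) : k) = a i (s i) / e ^ r := fun i => by simp [d]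
  have hγd : (γ : BaseRing k n →ₐ[k] BaseRing k n) = baseSubst (fun i => (d i : k)) σ := by
    refine MvPolynomial.algHom_ext fun p => ?_
    induction p using Sym2.ind with
    | _ i j =>
      rw [baseSubst_X, hd, hd]
      exact hrel' i j
  -- Now that γ is a monomial substitution, its effect on P is known, which fixes e.
  have he' : e = (∏ m, (d m : k)) ^ (n + 1) := by
    have h1 := baseSubst_tProd (fun i => (d i : k)) σ
    rw [← hγd] at h1
    have h2 : e • tProd k n = (∏ m, (d m : k)) ^ (n + 1) • tProd k n := hP.symm.trans h1
    exact smul_left_injective k tProd_ne_zero h2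
  refine ⟨d, σ, fun i j => ?_, fun i => ?_⟩
  · rw [← baseIncl_X, hg, hrel', map_smul, hd, hd]
    rfl
  · rw [ha, Finset.sum_eq_single (s i) (fun l _ hl => by simp [hs' i l hl]) (by simp), hd, pow_mul,
      ← he', div_mul_cancel₀ _ (pow_ne_zero _ he)]
    rfl

theorem zB_ne_zero (i : Fin n) : zB k n r i ≠ 0 := by
  intro h
  have h1 : z k n r i = 0 := congrArg Subtype.val h
  rw [z_eq_smul] at h1
  have h2 : x k n i = 0 := CliffordAlgebra.smul_left_cancel _ (pow_ne_zero r tProd_ne_zero)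
    (h1.trans (smul_zero _).symm)
  have h3 := x_mul_self (k := k) i
  rw [h2, mul_zero] at h3
  exact X_ne_zero (R := k) s(i, i) ((map_eq_zero_iff _
    (CliffordAlgebra.algebraMap_injective (genericForm k n))).1 h3.symm)

/-- The monomial group acts faithfully on `B_{g,r}` when `n` is even. -/
theorem injective_of_formulas (hn : Even n)
    (Φ : MonomialGroup k n →* (B k n r ≃ₐ[k] B k n r))
    (h1 : ∀ g i j, Φ g (tB k n r i j) =
      ((g.left (g.right i) : k) * (g.left (g.right j) : k)) • tB k n r (g.right i) (g.right j))
    (h2 : ∀ g i, Φ g (zB k n r i) =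
      ((g.left (g.right i) : k) * (∏ m, (g.left m : k)) ^ ((n + 1) * r)) •
        zB k n r (g.right i)) : Function.Injective Φ := by
  rw [injective_iff_map_eq_one]
  rintro ⟨d, σ⟩ h
  have ht : ∀ i j, ((1 : k) • X s(i, j) : BaseRing k n) = ((d (σ i) : k) * (d (σ j) : k)) •
      X s(σ i, σ j) := by
    intro i j
    have := h1 ⟨d, σ⟩ i j
    rw [h, ← baseIncl_X, ← baseIncl_X, ← map_smul] at this
    rw [one_smul]
    exact baseIncl_injective this
  obtain rfl : σ = 1 := Equiv.ext fun i => by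
    simpa using (smul_X_inj one_ne_zero (ht i i)).symm
  have hd : ∀ i j, (d i : k) * d j = 1 := fun i j => by
    have := congrArg (MvPolynomial.eval fun _ => (1 : k)) (ht i j)
    simpa using this.symm
  have hone : ∀ i, d i = 1 := by
    intro i
    -- All d_m coincide and square to 1; an even number of them multiply to 1. The formula for z_i
    -- then excludes d = -1.
    have hprod : ∏ m, (d m : k) = 1 := by
      have e : ∀ m, (d m : k) = d i := fun m =>
        mul_right_cancel₀ (d i).ne_zero ((hd m i).trans (hd i i).symm)
      obtain ⟨l, hl⟩ := hn
      rw [Finset.prod_congr rfl fun m _ => e m, Finset.prod_const, Finset.card_univ,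
        Fintype.card_fin, hl, ← two_mul, pow_mul, sq, hd, one_pow]
    have hz := h2 ⟨d, 1⟩ i
    rw [h] at hz
    simp only [Equiv.Perm.coe_one, id_eq, hprod, one_pow, mul_one] at hz
    have h3 : (1 : k) • zB k n r i = (d i : k) • zB k n r i := (one_smul k _).trans hz
    exact Units.ext (smul_left_injective k (zB_ne_zero i) h3).symm
  have : d = 1 := funext hone
  subst this
  rfl

end Classification

end GenericClifford

/-! ### Assembly of the main theorem -/

theorem mainTheorem10 {k : Type*} [Field k] [CharZero k] (n r : ℕ) (hn : Even n) (hr : n < r) :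
    (∀ g : GenericClifford.B k n r ≃ₐ[k] GenericClifford.B k n r,
      GenericClifford.IsGradedAut g) ∧
    ∃ Φ : GenericClifford.MonomialGroup k n ≃*
        (GenericClifford.B k n r ≃ₐ[k] GenericClifford.B k n r),
      ∀ (d : Fin n → kˣ) (σ : Equiv.Perm (Fin n)),
        (∀ i j : Fin n, Φ ⟨d, σ⟩ (GenericClifford.tB k n r i j) =
          ((d (σ i) : k) * (d (σ j) : k)) • GenericClifford.tB k n r (σ i) (σ j)) ∧
        (∀ i : Fin n, Φ ⟨d, σ⟩ (GenericClifford.zB k n r i) =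
          ((d (σ i) : k) * (∏ m : Fin n, (d m : k)) ^ ((n + 1) * r)) •
            GenericClifford.zB k n r (σ i)) := by
  obtain ⟨Φ, h1, h2, h3⟩ := GenericClifford.exists_monoidHom k n r
  have hsurj : Function.Surjective Φ := by
    intro g
    obtain ⟨d, σ, ht, hz⟩ := GenericClifford.exists_monomial hn (by omega) g
    refine ⟨⟨d, σ⟩, ?_⟩
    have h : (Φ ⟨d, σ⟩ : GenericClifford.B k n r →ₐ[k] GenericClifford.B k n r) = g :=
      GenericClifford.algHom_B_ext (fun i j => (h1 _ i j).trans (ht i j).symm)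
        fun i => (h2 _ i).trans (hz i).symm
    exact AlgEquiv.ext fun b => DFunLike.congr_fun h b
  have hinj : Function.Injective Φ := GenericClifford.injective_of_formulas hn Φ h1 h2
  refine ⟨fun g m => ?_, MulEquiv.ofBijective Φ ⟨hinj, hsurj⟩, fun d σ => ⟨h1 ⟨d, σ⟩, h2 ⟨d, σ⟩⟩⟩
  -- Surjectivity makes every automorphism monomial, hence degree preserving; using this for g and
  -- for its inverse gives equality.
  have hle : ∀ (g : GenericClifford.B k n r ≃ₐ[k] GenericClifford.B k n r) (m : ℕ),
      ∀ b ∈ GenericClifford.pieceB k n r m, g b ∈ GenericClifford.pieceB k n r m := by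
    intro g
    obtain ⟨a, rfl⟩ := hsurj g
    exact h3 a
  refine le_antisymm ?_ fun b hb => ?_
  · rintro _ ⟨b, hb, rfl⟩
    exact hle g m b hb
  · exact ⟨g.symm b, hle g.symm m b hb, g.apply_symm_apply b⟩
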